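/- Let $n\ge 1$ be an integer, $\sigma\in(0,2]$, $\mu>0$, and let $u_0,u_1\in L^1(\mathbb{R}^n)\cap L^2(\mathbb{R}^n)$ be real-valued with $\int_{\mathbb{R}^n}u_1(x)\,dx>0$ (no sign condition is imposed on $u_0$). If $$1<p\le 1+\frac{\min\{\sigma,1\}}{n},$$ then the Cauchy problem $$u_{tt}-\Delta u+\mu(-\Delta)^{\sigma/2}u_t=|u_t|^p\ \ (t>0,\ x\in\mathbb{R}^n),\qquad u(0,x)=u_0(x),\quad u_t(0,x)=u_1(x)$$ has no global (in time) weak solution. Here $(-\Delta)^{\sigma/2}$ is the classical $-\Delta$ if $\sigma=2$, and for $\sigma\in(0,2)$, with $s=\sigma/2$, $$(-\Delta)^{s}v(x)=C_{n,s}\ \mathrm{p.v.}\!\int_{\mathbb{R}^n}\frac{v(x)-v(y)}{|x-y|^{n+2s}}\,dy,\qquad C_{n,s}=\frac{4^s\,\Gamma(\frac n2+s)}{\pi^{n/2}\,|\Gamma(-s)|}.$$ A global weak solution is a real-valued $u\in L^1_{loc}((0,\infty);L^2(\mathbb{R}^n))$ with weak time derivative $u_t\in L^p_{loc}((0,\infty);L^{2p}(\mathbb{R}^n))\cap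 L^1_{loc}((0,\infty);L^2(\mathbb{R}^n))$ that attains the initial value $u(0)=u_0$ (in the sense that $u(t)\rightharpoonup u_0$ weakly in $L^2(\mathbb{R}^n)$ as $t\to0^+$, up to a null set of times), and such that for every $\varphi\in C([0,\infty);H^2(\mathbb{R}^n))\cap C^1([0,\infty);L^2(\mathbb{R}^n))$ with compact support in time, the time integrals below converge absolutely and $$\int_0^\infty\!\!\int_{\mathbb{R}^n}|u_t|^p\varphi\,dx\,dt+\int_{\mathbb{R}^n}u_1(x)\varphi(0,x)\,dx=-\int_0^\infty\!\!\int_{\mathbb{R}^n}u_t\,\varphi_t\,dx\,dt-\int_0^\infty\!\!\int_{\mathbb{R}^n}u\,\Delta\varphi\,dx\,dt+\mu\int_0^\infty\!\!\int_{\mathbb{R}^n}u_t\,(-\Delta)^{\sigma/2}\varphi\,dx\,dt.$$ -/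

import Mathlib

open MeasureTheory Set Filter
open scoped ContDiff Topology

namespace DampedWave

/-- Euclidean space `ℝⁿ`. -/
abbrev E (n : ℕ) := EuclideanSpace ℝ (Fin n)

/-- The real Hilbert space `L²(ℝⁿ)`. -/
noncomputable abbrev L2 (n : ℕ) := Lp ℝ 2 (volume : Measure (E n))

/-- `w ∈ L²(ℝⁿ)` is the weak partial derivative `∂ᵢ v` of `v ∈ L²(ℝⁿ)`. -/
def HasWeakPartial {n : ℕ} (i : Fin n) (v w : L2 n) : Prop :=
  ∀ χ : E n → ℝ, ContDiff ℝ ∞ χ → HasCompactSupport χ →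
    ∫ x, v x * fderiv ℝ χ x (EuclideanSpace.single i 1) = -∫ x, w x * χ x

/-- A function `φ ∈ C([0,∞); H²(ℝⁿ)) ∩ C¹([0,∞); L²(ℝⁿ))` with compact support in time, together
with its time derivative and its weak space derivatives of first and second order (all of which are
determined on `[0,∞)` by `val`). Continuity into `H²` is continuity into `L²` of the function
and of its derivatives up to order two. Values at negative times play no role. -/
structure TestFunction (n : ℕ) where
  /-- the function `t ↦ φ(t,·)` -/
  val : ℝ → L2 n
  /-- the time derivative `φ_t` -/
  dt : ℝ → L2 n
  /-- the weak derivatives `∂ᵢ φ` -/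
  grad : Fin n → ℝ → L2 n
  /-- the weak derivatives `∂ⱼ ∂ᵢ φ` -/
  hess : Fin n → Fin n → ℝ → L2 n
  hasWeakPartial_val : ∀ t, 0 ≤ t → ∀ i, HasWeakPartial i (val t) (grad i t)
  hasWeakPartial_grad : ∀ t, 0 ≤ t → ∀ i j, HasWeakPartial j (grad i t) (hess i j t)
  continuousOn_val : ContinuousOn val (Ici 0)
  continuousOn_grad : ∀ i, ContinuousOn (grad i) (Ici 0)
  continuousOn_hess : ∀ i j, ContinuousOn (hess i j) (Ici 0)
  hasDerivWithinAt_val : ∀ t, 0 ≤ t → HasDerivWithinAt val (dt t) (Ici 0) t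
  continuousOn_dt : ContinuousOn dt (Ici 0)
  compactSupport : ∃ T : ℝ, ∀ t, T ≤ t → val t = 0

/-- The Laplacian `Δφ(t,·) ∈ L²(ℝⁿ)` of a test function. -/
noncomputable def TestFunction.laplacian {n : ℕ} (φ : TestFunction n) (t : ℝ) : L2 n :=
  ∑ i, φ.hess i i t

/-- The normalization constant `4^s Γ(n/2+s) / (π^{n/2} |Γ(-s)|)` of `(-Δ)^s`. -/
noncomputable def fracConst (n : ℕ) (s : ℝ) : ℝ :=
  4 ^ s * Real.Gamma (n / 2 + s) / (Real.pi ^ ((n : ℝ) / 2) * |Real.Gamma (-s)|)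

/-- The fractional Laplacian
`(-Δ)^s v(x) = C_{n,s} p.v. ∫ (v(x) - v(y)) / |x - y|^{n+2s} dy`, `0 < s < 1`.
For `v ∈ H²(ℝⁿ)` the principal value exists at almost every `x`. -/
noncomputable def fracLaplacian {n : ℕ} (s : ℝ) (v : E n → ℝ) (x : E n) : ℝ :=
  limUnder (𝓝[>] (0 : ℝ)) fun ε : ℝ =>
    fracConst n s * ∫ y in {y : E n | ε < ‖x - y‖}, (v x - v y) / ‖x - y‖ ^ ((n : ℝ) + 2 * s)

/-- `(-Δ)^{σ/2} φ(t,·)` for `0 < σ ≤ 2`: the classical `-Δφ(t,·)` if `σ = 2`, the fractional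
Laplacian otherwise. -/
noncomputable def TestFunction.damping {n : ℕ} (σ : ℝ) (φ : TestFunction n) (t : ℝ) : E n → ℝ :=
  open Classical in
  if σ = 2 then fun x => -(φ.laplacian t) x else fracLaplacian (σ / 2) (φ.val t)

/-- `w` is the weak derivative on `(0,∞)` of the `L²(ℝⁿ)`-valued function `u`. -/
def HasWeakTimeDeriv {n : ℕ} (u w : ℝ → L2 n) : Prop :=
  ∀ χ : ℝ → ℝ, ContDiff ℝ ∞ χ → HasCompactSupport χ → tsupport χ ⊆ Ioi 0 →
    ∫ t in Ioi (0 : ℝ), deriv χ t • u t = -∫ t in Ioi (0 : ℝ), χ t • w t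

/-- `u` (with time derivative `ut`) is a global weak solution of
`u_tt - Δu + μ (-Δ)^{σ/2} u_t = |u_t|^p`, `u(0) = u₀`, `u_t(0) = u₁`. -/
structure IsGlobalWeakSolutionWith {n : ℕ} (σ μ p : ℝ) (u₀ u₁ : E n → ℝ)
    (u ut : ℝ → L2 n) : Prop where
  /-- `u ∈ L¹_loc((0,∞); L²)` -/
  locallyIntegrableOn : LocallyIntegrableOn u (Ioi 0)
  hasWeakTimeDeriv : HasWeakTimeDeriv u ut
  /-- `u_t ∈ L¹_loc((0,∞); L²)` -/
  locallyIntegrableOn_ut : LocallyIntegrableOn ut (Ioi 0)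
  /-- `u_t ∈ L^p_loc((0,∞); L^{2p})`; strong measurability into `L^{2p}` is inherited from `L²` -/
  locally_Lp_ut : ∀ K : Set ℝ, IsCompact K → K ⊆ Ioi 0 →
    ∫⁻ t in K, (eLpNorm (ut t) (ENNReal.ofReal (2 * p)) volume) ^ p < ⊤
  /-- `u(0) = u₀`: the function `u`, which is continuous in time up to a null set of times, tends
  to `u₀` weakly in `L²` as `t → 0+`. The filter discards null sets of times. -/
  initial : ∀ v : L2 n,
    Tendsto (fun t => ∫ x, u t x * v x) (𝓝[>] (0 : ℝ) ⊓ ae volume) (𝓝 (∫ x, u₀ x * v x))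
  /-- The time integrals in the weak formulation converge. -/
  integrable : ∀ φ : TestFunction n,
    IntegrableOn (fun t => ∫ x, |ut t x| ^ p * φ.val t x) (Ioi 0) ∧
    IntegrableOn (fun t => ∫ x, ut t x * φ.dt t x) (Ioi 0) ∧
    IntegrableOn (fun t => ∫ x, u t x * φ.laplacian t x) (Ioi 0) ∧
    IntegrableOn (fun t => ∫ x, ut t x * φ.damping σ t x) (Ioi 0)
  /-- The weak formulation. -/
  weak : ∀ φ : TestFunction n,
    (∫ t in Ioi (0 : ℝ), ∫ x, |ut t x| ^ p * φ.val t x) + ∫ x, u₁ x * φ.val 0 x =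
      -(∫ t in Ioi (0 : ℝ), ∫ x, ut t x * φ.dt t x)
      - (∫ t in Ioi (0 : ℝ), ∫ x, u t x * φ.laplacian t x)
      + μ * ∫ t in Ioi (0 : ℝ), ∫ x, ut t x * φ.damping σ t x

/-- `u` is a global weak solution of the Cauchy problem. -/
def IsGlobalWeakSolution {n : ℕ} (σ μ p : ℝ) (u₀ u₁ : E n → ℝ) (u : ℝ → L2 n) : Prop :=
  ∃ ut : ℝ → L2 n, IsGlobalWeakSolutionWith σ μ p u₀ u₁ u ut

end DampedWave

namespace DampedWave

/-! This is a test function argument with product functions `η(t) w(x)`: `η` is a cutoff at time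
scale `T = R^m`, `m = min σ 1`, and `w(x) = (1 + |x|²/R²)^(-q)` with `q = n/2 + σ/2`. A compactly
supported spatial cutoff would not be dominated by itself after a nonlocal operator. The weight
decays like the kernel `|x|^(-n-σ)`, and this gives the pointwise bound `|(-Δ)^{σ/2} w| ≤ C R^(-σ)
w` (`exists_abs_fracLaplacian_weight_le` for `σ < 2`, the bound on second derivatives for `σ = 2`).

The three linear terms then have coefficient at most a constant times `R^(-m)`. The term with `η'`
costs `1/T`, and the damping costs `R^(-σ)`. The term `∫∫ u Δφ` is first integrated by parts in
time, so that `u` is replaced by `u_t` and `η` by its tail integral `Θ ≤ 2Tη`; it costs `T R^(-2) ≤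
R^(-m)` because `m ≤ 1`. The boundary term from `u₀` is at most a multiple of `T R^(-2) ‖u₀‖₁`,
which tends to zero; hence no sign of `u₀` matters. The outcome is `WeakInequality`.

Young's inequality absorbs half of `∫∫ |u_t|^p φ` and leaves a remainder of order `R^(-m p/(p-1) + n
+ m)`. This stays bounded exactly when `n(p-1) ≤ m`, the assumed range. So the weighted integral of
`|u_t|^p` over `(0, 2R^m]` is bounded uniformly in `R` (`exists_bound_integral_weightedPower`).

At the critical exponent the remainder does not decay, and the nonlocal term is not confined to a
region escaping to infinity. Smallness comes from splitting off the contribution at a fixed scale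
`R₀` for which this integral nearly attains its supremum over `R ≥ 1` (`eventually_integral_le`). On
the rest, Young is used with a large constant `L` in front of `|u_t|^p`: its remainder is small, and
the increment of the integral beyond `R₀` is smaller than a multiple of `1/L`. On the fixed part a
small constant suffices, since the coefficient `R^(-m)` tends to zero while the volume is fixed. The
right side of the weak inequality thus becomes arbitrarily small, whereas the left side is at least
a quantity tending to `∫ u₁ > 0`. -/

/-- The polynomially decaying weight `(1 + a |x|²)^(-q)`. -/
noncomputable def weight {n : ℕ} (q a : ℝ) (x : E n) : ℝ := (1 + a * ‖x‖ ^ 2) ^ (-q)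

/-! ### The polynomial weight and its derivatives. -/

section weight

variable {n : ℕ} {q a : ℝ}

theorem one_le_base (ha : 0 ≤ a) (x : E n) : 1 ≤ 1 + a * ‖x‖ ^ 2 :=
  le_add_of_nonneg_right (by positivity)

theorem weight_pos (ha : 0 ≤ a) (x : E n) : 0 < weight q a x :=
  Real.rpow_pos_of_pos (by linarith [one_le_base ha x]) _

theorem weight_le_one (hq : 0 ≤ q) (ha : 0 ≤ a) (x : E n) : weight q a x ≤ 1 :=
  Real.rpow_le_one_of_one_le_of_nonpos (one_le_base ha x) (by linarith)

theorem weight_neg (x : E n) : weight q a (-x) = weight q a x := by simp [weight]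

theorem weight_smul (b : ℝ) (x : E n) : weight q 1 (b • x) = weight q (b ^ 2) x := by
  simp [weight, norm_smul, mul_pow]

theorem weight_anti {b : ℝ} (hq : 0 ≤ q) (ha : 0 ≤ a) (hab : a ≤ b) (x : E n) :
    weight q b x ≤ weight q a x :=
  Real.rpow_le_rpow_of_nonpos (by linarith [one_le_base ha x]) (by gcongr) (by linarith)

theorem weight_succ_mul (ha : 0 ≤ a) (x : E n) :
    weight (q + 1) a x * (1 + a * ‖x‖ ^ 2) = weight q a x := by
  have h := one_le_base ha x
  unfold weight
  rw [show -q = -(q + 1) + 1 by ring, Real.rpow_add (by linarith), Real.rpow_one]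

theorem continuous_weight (ha : 0 ≤ a) : Continuous (weight q a : E n → ℝ) := by
  unfold weight
  refine Continuous.rpow_const (by fun_prop) fun x => Or.inl ?_
  linarith [one_le_base ha x]

theorem integrable_weight_one (hq : (n : ℝ) < 2 * q) :
    Integrable (weight q 1 : E n → ℝ) := by
  have := integrable_rpow_neg_one_add_norm_sq (E := E n) (μ := volume) (r := 2 * q) (by simpa)
  refine this.congr (Eventually.of_forall fun x => ?_)
  simp only [weight]
  congr 1
  · ring
  · ring

theorem integrable_weight_sq (hq : (n : ℝ) < 2 * q) {b : ℝ} (hb : 0 < b) :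
    Integrable (weight q (b ^ 2) : E n → ℝ) := by
  have := (integrable_weight_one hq).comp_smul hb.ne'
  simpa only [weight_smul] using this

theorem integral_weight_sq {b : ℝ} (hb : 0 < b) :
    ∫ x : E n, weight q (b ^ 2) x = (b ^ n)⁻¹ * ∫ x : E n, weight q 1 x := by
  have := Measure.integral_comp_smul (volume : Measure (E n)) (weight q 1) b
  simp only [weight_smul] at this
  rw [this, abs_of_pos (by positivity)]
  simp

/-- The differential of `weight q a` at `x` in direction `z`. -/
noncomputable def weightDeriv (q a : ℝ) (x z : E n) : ℝ :=
  -(2 * q * a) * (weight (q + 1) a x * inner ℝ x z)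

/-- The second differential of `weight q a` at `x` in the directions `z` and `v`. -/
noncomputable def weightHess (q a : ℝ) (x z v : E n) : ℝ :=
  -(2 * q * a) * (weightDeriv (q + 1) a x v * inner ℝ x z + weight (q + 1) a x * inner ℝ v z)

theorem hasFDerivAt_weight (ha : 0 ≤ a) (x : E n) :
    HasFDerivAt (weight q a) ((-(2 * q * a) * weight (q + 1) a x) • innerSL ℝ x) x := by
  have h1 : HasFDerivAt (fun x : E n => 1 + a * ‖x‖ ^ 2) (a • (2 • innerSL ℝ x)) x :=
    ((hasStrictFDerivAt_norm_sq x).hasFDerivAt.const_mul a).const_add 1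
  have h2 := h1.rpow_const (p := -q) (Or.inl (by linarith [one_le_base ha x]))
  refine h2.congr_fderiv ?_
  ext z
  simp [weight]
  rw [show -q - 1 = -1 + -q by ring]
  ring

theorem differentiable_weight (ha : 0 ≤ a) : Differentiable ℝ (weight q a : E n → ℝ) :=
  fun x => (hasFDerivAt_weight ha x).differentiableAt

theorem fderiv_weight (ha : 0 ≤ a) (x z : E n) :
    fderiv ℝ (weight q a) x z = weightDeriv q a x z := by
  rw [(hasFDerivAt_weight ha x).fderiv]
  simp [weightDeriv]
  ring

theorem differentiable_weightDeriv (ha : 0 ≤ a) (z : E n) :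
    Differentiable ℝ (fun x => weightDeriv q a x z) := by
  unfold weightDeriv
  have := differentiable_weight (n := n) (q := q + 1) ha
  have h : Differentiable ℝ fun x : E n => inner ℝ x z :=
    differentiable_id.inner ℝ (differentiable_const z)
  fun_prop

theorem fderiv_weightDeriv (ha : 0 ≤ a) (x z v : E n) :
    fderiv ℝ (fun x => weightDeriv q a x z) x v = weightHess q a x z v := by
  have h1 : HasFDerivAt (fun y : E n => inner ℝ y z) (innerSL ℝ z) x := by
    refine (innerSL ℝ z).hasFDerivAt.congr_of_eventuallyEq (Eventually.of_forall fun y => ?_)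
    exact real_inner_comm _ _
  have h : HasFDerivAt (fun y : E n => -(2 * q * a) * (weight (q + 1) a y * inner ℝ y z)) _ x :=
    (((differentiable_weight (n := n) (q := q + 1) ha) x).hasFDerivAt.mul h1).const_mul
      (-(2 * q * a))
  unfold weightDeriv
  rw [h.fderiv]
  simp only [smul_apply, add_apply, smul_eq_mul,
    fderiv_weight ha, weightHess, innerSL_apply_apply, real_inner_comm v z]
  ring

theorem continuous_weightDeriv (ha : 0 ≤ a) (z : E n) :
    Continuous (fun x => weightDeriv q a x z) :=
  (differentiable_weightDeriv ha z).continuous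

theorem continuous_weightHess (ha : 0 ≤ a) (z v : E n) :
    Continuous (fun x => weightHess q a x z v) := by
  unfold weightHess
  have := continuous_weightDeriv (n := n) (q := q + 1) ha v
  have := continuous_weight (n := n) (q := q + 1) ha
  fun_prop

/-- Two differentiations cost one factor `a` and no decay: the factor `a |x|²` produced by the two
gradients is absorbed by one power of `1 + a |x|²`. With `a = R^(-2)` this is the scaling of the
Laplacian. -/
theorem abs_weightHess_le (hq : 0 ≤ q) (ha : 0 ≤ a) (x z v : E n) :
    |weightHess q a x z v| ≤ (2 * q * (2 * (q + 1) + 1)) * a * weight q a x * ‖z‖ * ‖v‖ := by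
  have hb := one_le_base ha x
  have e1 := weight_succ_mul (q := q) ha x
  have e2 := weight_succ_mul (q := q + 1) ha x
  have w1 := weight_pos (q := q + 1) ha x
  have w2 := weight_pos (q := q + 1 + 1) ha x
  have hx : a * ‖x‖ ^ 2 * weight (q + 1 + 1) a x ≤ weight (q + 1) a x := by nlinarith
  have hw : weight (q + 1) a x ≤ weight q a x := by nlinarith
  have i1 := abs_real_inner_le_norm x z
  have i2 := abs_real_inner_le_norm x v
  have i3 := abs_real_inner_le_norm v z
  have w0 := (weight_pos (q := q) ha x).le
  have t1 : |weightDeriv (q + 1) a x v * inner ℝ x z|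
      ≤ 2 * (q + 1) * weight q a x * ‖z‖ * ‖v‖ := by
    calc |weightDeriv (q + 1) a x v * inner ℝ x z|
        = 2 * (q + 1) * a * weight (q + 1 + 1) a x * |inner ℝ x v| * |inner ℝ x z| := by
          rw [weightDeriv, abs_mul, abs_mul, abs_mul, abs_neg, abs_of_pos w2,
            abs_of_nonneg (show 0 ≤ 2 * (q + 1) * a by positivity)]
          ring
      _ ≤ 2 * (q + 1) * a * weight (q + 1 + 1) a x * (‖x‖ * ‖v‖) * (‖x‖ * ‖z‖) := by gcongr
      _ = 2 * (q + 1) * (a * ‖x‖ ^ 2 * weight (q + 1 + 1) a x) * ‖z‖ * ‖v‖ := by ring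
      _ ≤ _ := by gcongr; exact hx.trans hw
  have t2 : |weight (q + 1) a x * inner ℝ v z| ≤ weight q a x * ‖z‖ * ‖v‖ := by
    rw [abs_mul, abs_of_pos w1]
    calc weight (q + 1) a x * |inner ℝ v z| ≤ weight q a x * (‖v‖ * ‖z‖) := by gcongr
      _ = _ := by ring
  rw [weightHess, abs_mul, abs_neg, abs_of_nonneg (show 0 ≤ 2 * q * a by positivity)]
  calc _ ≤ 2 * q * a * (2 * (q + 1) * weight q a x * ‖z‖ * ‖v‖ + weight q a x * ‖z‖ * ‖v‖) := by
        gcongr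
        exact (abs_add_le _ _).trans (add_le_add t1 t2)
    _ = _ := by ring

/-- The factor `1 + a` is not scale-sharp; the bound serves only to place the gradient in `L²`. -/
theorem abs_weightDeriv_le (hq : 0 ≤ q) (ha : 0 ≤ a) (x z : E n) :
    |weightDeriv q a x z| ≤ 2 * q * (1 + a) * weight q a x * ‖z‖ := by
  have e1 := weight_succ_mul (q := q) ha x
  have w1 := weight_pos (q := q + 1) ha x
  have i1 := abs_real_inner_le_norm x z
  have hx : a * ‖x‖ ≤ (1 + a) * (1 + a * ‖x‖ ^ 2) := by
    have : a * ‖x‖ ≤ a * (1 + ‖x‖ ^ 2) := by gcongr; nlinarith [sq_nonneg (‖x‖ - 1)]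
    nlinarith [mul_nonneg ha (mul_nonneg ha (sq_nonneg ‖x‖))]
  calc |weightDeriv q a x z| = 2 * q * a * (weight (q + 1) a x * |inner ℝ x z|) := by
        rw [weightDeriv, abs_mul, abs_mul, abs_neg, abs_of_pos w1,
            abs_of_nonneg (show 0 ≤ 2 * q * a by positivity)]
    _ ≤ 2 * q * a * (weight (q + 1) a x * (‖x‖ * ‖z‖)) := by gcongr
    _ = 2 * q * weight (q + 1) a x * (a * ‖x‖) * ‖z‖ := by ring
    _ ≤ 2 * q * weight (q + 1) a x * ((1 + a) * (1 + a * ‖x‖ ^ 2)) * ‖z‖ := by gcongr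
    _ = 2 * q * (1 + a) * (weight (q + 1) a x * (1 + a * ‖x‖ ^ 2)) * ‖z‖ := by ring
    _ = _ := by rw [e1]

theorem integrable_of_le_weight (hq : (n : ℝ) < 2 * q) {b : ℝ} (hb : 0 < b) {f : E n → ℝ} {C : ℝ}
    (hf : AEStronglyMeasurable f) (hle : ∀ x, |f x| ≤ C * weight q (b ^ 2) x) : Integrable f :=
  ((integrable_weight_sq hq hb).const_mul C).mono' hf (Eventually.of_forall hle)

theorem memLp_of_le_weight (hq : (n : ℝ) < 2 * q) {b : ℝ} (hb : 0 < b) {f : E n → ℝ} {C : ℝ}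
    (hf : AEStronglyMeasurable f) (hle : ∀ x, |f x| ≤ C * weight q (b ^ 2) x) : MemLp f 2 := by
  have hq0 : 0 ≤ q := by have := n.cast_nonneg (α := ℝ); linarith
  refine (memLp_two_iff_integrable_sq hf).2 ?_
  refine integrable_of_le_weight hq hb (C := C ^ 2) (hf.pow 2) fun x => ?_
  have h1 := weight_le_one hq0 (sq_nonneg b) x
  have h0 := weight_pos (q := q) (sq_nonneg b) x
  rw [abs_pow]
  calc |f x| ^ 2 ≤ (C * weight q (b ^ 2) x) ^ 2 := by gcongr; exact hle x
    _ = C ^ 2 * (weight q (b ^ 2) x * weight q (b ^ 2) x) := by ring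
    _ ≤ C ^ 2 * (weight q (b ^ 2) x * 1) := by gcongr
    _ = _ := by ring

end weight

/-- A differentiable function in `L²` with gradient in `L²` has weak partial derivatives. -/
theorem hasWeakPartial_of_differentiable {n : ℕ} (i : Fin n) {f g : E n → ℝ}
    (hf : MemLp f 2) (hg : MemLp g 2) (hd : Differentiable ℝ f)
    (hfg : ∀ x, fderiv ℝ f x (EuclideanSpace.single i 1) = g x) :
    HasWeakPartial i (hf.toLp f) (hg.toLp g) := by
  intro χ hχ hc
  have e1 : ∫ x, (hf.toLp f) x * fderiv ℝ χ x (EuclideanSpace.single i 1)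
      = ∫ x, f x * fderiv ℝ χ x (EuclideanSpace.single i 1) :=
    integral_congr_ae (hf.coeFn_toLp.mono fun x hx => by simp only [hx])
  have e2 : ∫ x, (hg.toLp g) x * χ x = ∫ x, g x * χ x :=
    integral_congr_ae (hg.coeFn_toLp.mono fun x hx => by simp only [hx])
  have hχ2 : MemLp χ 2 := hχ.continuous.memLp_of_hasCompactSupport hc
  have hdχ : Continuous fun x => fderiv ℝ χ x (EuclideanSpace.single i 1) :=
    (hχ.continuous_fderiv (by simp)).clm_apply continuous_const
  have hdχ2 : MemLp (fun x => fderiv ℝ χ x (EuclideanSpace.single i 1)) 2 :=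
    hdχ.memLp_of_hasCompactSupport (hc.fderiv_apply ℝ _)
  rw [e1, e2]
  have := integral_mul_fderiv_eq_neg_fderiv_mul_of_integrable (μ := (volume : Measure (E n)))
    (f := f) (g := χ) (v := EuclideanSpace.single i 1)
    (by simp only [hfg]; exact hg.integrable_mul hχ2) (hf.integrable_mul hdχ2)
    (hf.integrable_mul hχ2) (fun x _ => hd x) (fun x _ => (hχ.differentiable (by simp)) x)
  simpa only [hfg] using this

/-! ### The fractional Laplacian of the weight. -/

section fractional

variable {n : ℕ} {q s : ℝ}

/-- The second symmetric difference quotient whose integral is the fractional Laplacian. -/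
noncomputable def diffQuot (s : ℝ) (v : E n → ℝ) (x z : E n) : ℝ :=
  (2 * v x - v (x - z) - v (x + z)) / ‖z‖ ^ ((n : ℝ) + 2 * s)

/-- Away from the origin the singular kernel is comparable to the weight of the same decay. The far
part of the fractional Laplacian therefore reduces to products of two weights. -/
theorem inv_rpow_norm_le_weight (hq : 0 ≤ q) {ε : ℝ} (hε : 0 < ε) {z : E n} (hz : ε ≤ ‖z‖) :
    1 / ‖z‖ ^ (2 * q) ≤ (1 + (ε ^ 2)⁻¹) ^ q * weight q 1 z := by
  have hz0 : 0 < ‖z‖ := hε.trans_le hz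
  have h1 : 1 + 1 * ‖z‖ ^ 2 ≤ (1 + (ε ^ 2)⁻¹) * ‖z‖ ^ 2 := by
    have : 1 ≤ (ε ^ 2)⁻¹ * ‖z‖ ^ 2 := by
      rw [inv_mul_eq_div, one_le_div (by positivity)]
      gcongr
    linarith
  have h2 : (1 + 1 * ‖z‖ ^ 2) ^ q ≤ (1 + (ε ^ 2)⁻¹) ^ q * ‖z‖ ^ (2 * q) := by
    refine (Real.rpow_le_rpow (by positivity) h1 hq).trans_eq ?_
    rw [Real.mul_rpow (by positivity) (by positivity), Real.rpow_mul (norm_nonneg z) 2 q,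
      Real.rpow_two]
  rw [weight, Real.rpow_neg (by positivity), ← div_eq_mul_inv, div_le_div_iff₀ (by positivity)
    (by positivity)]
  linarith

theorem integrable_indicator_kernel (hq : (n : ℝ) < 2 * q) {ε : ℝ} (hε : 0 < ε) :
    Integrable ({z : E n | ε < ‖z‖}.indicator fun z => 1 / ‖z‖ ^ (2 * q)) := by
  have hq0 : 0 ≤ q := by have := n.cast_nonneg (α := ℝ); linarith
  refine ((integrable_weight_one hq).const_mul ((1 + (ε ^ 2)⁻¹) ^ q)).mono' ?_
    (Eventually.of_forall fun z => ?_)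
  · refine Measurable.aestronglyMeasurable (Measurable.indicator (by fun_prop) ?_)
    exact measurableSet_lt measurable_const measurable_norm
  · by_cases hz : ε < ‖z‖
    · rw [indicator_of_mem (show z ∈ {z : E n | ε < ‖z‖} from hz), Real.norm_of_nonneg
        (by positivity)]
      exact inv_rpow_norm_le_weight hq0 hε hz.le
    · rw [indicator_of_notMem (show z ∉ {z : E n | ε < ‖z‖} from hz), norm_zero]
      have := weight_pos (q := q) zero_le_one z
      positivity

/-- For bounded continuous `v`, the principal value at `x` is the integral of the symmetrized
integrand, if that is integrable. -/
theorem fracLaplacian_eq_integral (hs : 0 < s) {v : E n → ℝ} {M : ℝ} (hv : Continuous v)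
    (hM : ∀ x, |v x| ≤ M) (x : E n) (hint : Integrable (diffQuot s v x)) :
    fracLaplacian s v x = fracConst n s * (2⁻¹ * ∫ z, diffQuot s v x z) := by
  refine Tendsto.limUnder_eq (Tendsto.const_mul _ ?_)
  set N : ℝ := (n : ℝ) + 2 * s with hN
  have key : ∀ ε : ℝ, 0 < ε → ∫ y in {y : E n | ε < ‖x - y‖}, (v x - v y) / ‖x - y‖ ^ N
      = 2⁻¹ * ∫ z, {z : E n | ε < ‖z‖}.indicator (diffQuot s v x) z := by
    intro ε hε
    set f : E n → ℝ := {z : E n | ε < ‖z‖}.indicator fun z => (v x - v (x - z)) / ‖z‖ ^ N with hf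
    have hset : MeasurableSet {z : E n | ε < ‖z‖} :=
      measurableSet_lt measurable_const measurable_norm
    have hfi : Integrable f := by
      have h0 := (integrable_indicator_kernel (n := n) (q := N / 2)
        (by rw [hN]; linarith) hε).const_mul (2 * M)
      refine h0.mono' ?_ (Eventually.of_forall fun z => ?_)
      · refine Measurable.aestronglyMeasurable (Measurable.indicator ?_ hset)
        have := hv.measurable
        fun_prop
      · by_cases hz : ε < ‖z‖
        · rw [hf, indicator_of_mem (show z ∈ {z : E n | ε < ‖z‖} from hz),
            indicator_of_mem (show z ∈ {z : E n | ε < ‖z‖} from hz), norm_div,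
            Real.norm_of_nonneg (show 0 ≤ ‖z‖ ^ N by positivity), mul_one_div,
            show 2 * (N / 2) = N by ring]
          gcongr
          have := abs_sub (v x) (v (x - z))
          rw [Real.norm_eq_abs]
          linarith [hM x, hM (x - z)]
        · rw [hf, indicator_of_notMem (show z ∉ {z : E n | ε < ‖z‖} from hz),
            indicator_of_notMem (show z ∉ {z : E n | ε < ‖z‖} from hz)]
          simp
    have e1 : ∫ y in {y : E n | ε < ‖x - y‖}, (v x - v y) / ‖x - y‖ ^ N = ∫ z, f z := by
      rw [← integral_sub_left_eq_self f volume x, ← integral_indicator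
        (measurableSet_lt measurable_const (by fun_prop))]
      congr 1
      ext y
      simp only [hf, indicator, mem_ofPred_eq, sub_sub_cancel]
    have e2 : ∫ z, f (-z) = ∫ z, f z := integral_neg_eq_self f volume
    -- For fixed `ε` the truncated integrand is integrable, so it may be averaged with its
    -- reflection under `z ↦ -z`; the result is half the second difference quotient.
    have e3 : ∫ z, {z : E n | ε < ‖z‖}.indicator (diffQuot s v x) z
        = (∫ z, f z) + ∫ z, f (-z) := by
      rw [← integral_add hfi hfi.comp_neg]
      congr 1
      ext z
      by_cases hz : ε < ‖z‖
      · simp only [hf, indicator, mem_ofPred_eq, hz, norm_neg, if_true, diffQuot, sub_neg_eq_add]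
        ring
      · simp only [hf, indicator, mem_ofPred_eq, hz, norm_neg, if_false, add_zero]
    rw [e1, e3, e2]
    ring
  have hlim : Tendsto (fun ε : ℝ => 2⁻¹ * ∫ z, {z : E n | ε < ‖z‖}.indicator (diffQuot s v x) z)
      (𝓝[>] 0) (𝓝 (2⁻¹ * ∫ z, diffQuot s v x z)) := by
    refine Tendsto.const_mul _ ?_
    refine tendsto_integral_filter_of_dominated_convergence (fun z => ‖diffQuot s v x z‖) ?_ ?_
      hint.norm ?_
    · exact Eventually.of_forall fun ε => hint.aestronglyMeasurable.indicator
        (measurableSet_lt measurable_const measurable_norm)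
    · exact Eventually.of_forall fun ε => Eventually.of_forall fun z => norm_indicator_le_norm_self _ _
    · refine Eventually.of_forall fun z => ?_
      rcases eq_or_ne z 0 with rfl | hz
      -- No truncation contains the origin, but the numerator vanishes there, so the pointwise limit
      -- holds at `z = 0` as well.
      · have : diffQuot s v x 0 = 0 := by simp [diffQuot]; left; ring
        simp [indicator, this]
      · refine tendsto_const_nhds.congr' ?_
        filter_upwards [Ioo_mem_nhdsGT (norm_pos_iff.2 hz)] with ε hε
        rw [indicator_of_mem (show z ∈ {z : E n | ε < ‖z‖} from hε.2)]
  refine hlim.congr' ?_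
  filter_upwards [self_mem_nhdsWithin] with ε hε
  exact (key ε hε).symm

theorem weight_le_of_norm_sub_le_one (hq : 0 ≤ q) {x y : E n} (h : ‖x - y‖ ≤ 1) :
    weight q 1 y ≤ 3 ^ q * weight q 1 x := by
  have h1 : ‖x‖ ≤ ‖x - y‖ + ‖y‖ := by simpa using norm_add_le (x - y) y
  have h2 : (1 + 1 * ‖x‖ ^ 2) / 3 ≤ 1 + 1 * ‖y‖ ^ 2 := by
    nlinarith [sq_nonneg (‖y‖ - 1), norm_nonneg x, norm_nonneg y]
  calc weight q 1 y ≤ ((1 + 1 * ‖x‖ ^ 2) / 3) ^ (-q) :=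
        Real.rpow_le_rpow_of_nonpos (by positivity) h2 (by linarith)
    _ = 3 ^ q * weight q 1 x := by
        rw [Real.div_rpow (by nlinarith [sq_nonneg ‖x‖]) (by norm_num), weight,
          Real.rpow_neg (show (0 : ℝ) ≤ 3 by norm_num) q, div_inv_eq_mul, mul_comm]

/-- At least one of `|x - z|` and `|z|` is at least `|x|/2`, so one of the two weights is at most
`4^q` times the weight at `x`; the other is kept for integration in `z`. -/
theorem weight_mul_weight_le (hq : 0 ≤ q) (x z : E n) :
    weight q 1 (x - z) * weight q 1 z
      ≤ 4 ^ q * weight q 1 x * (weight q 1 (x - z) + weight q 1 z) := by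
  have aux : ∀ y : E n, (1 + 1 * ‖x‖ ^ 2) / 4 ≤ 1 + 1 * ‖y‖ ^ 2 →
      weight q 1 y ≤ 4 ^ q * weight q 1 x := by
    intro y hy
    calc weight q 1 y ≤ ((1 + 1 * ‖x‖ ^ 2) / 4) ^ (-q) :=
          Real.rpow_le_rpow_of_nonpos (by positivity) hy (by linarith)
      _ = 4 ^ q * weight q 1 x := by
          rw [Real.div_rpow (by nlinarith [sq_nonneg ‖x‖]) (by norm_num), weight,
            Real.rpow_neg (show (0 : ℝ) ≤ 4 by norm_num) q, div_inv_eq_mul, mul_comm]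
  have h1 : ‖x‖ ≤ ‖x - z‖ + ‖z‖ := by simpa using norm_add_le (x - z) z
  have w1 := weight_pos (q := q) zero_le_one (x - z)
  have w2 := weight_pos (q := q) zero_le_one z
  have w3 := weight_pos (q := q) zero_le_one x
  have w4 : (0 : ℝ) ≤ 4 ^ q * weight q 1 x := by positivity
  rcases le_total ‖z‖ ‖x - z‖ with h | h
  · have := aux (x - z) (by nlinarith [norm_nonneg x, norm_nonneg z])
    nlinarith
  · have := aux z (by nlinarith [norm_nonneg x, norm_nonneg (x - z)])
    nlinarith

/-- Mean value theorem twice: the bound on the second derivative makes the gradient Lipschitz on the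
unit ball around `x`, where all values of the weight are comparable to its value at `x`. -/
theorem abs_weight_secondDiff_le (hq : 0 ≤ q) {x z : E n} (hz : ‖z‖ ≤ 1) :
    |2 * weight q 1 x - weight q 1 (x - z) - weight q 1 (x + z)|
      ≤ 2 * ((2 * q * (2 * (q + 1) + 1)) * 3 ^ q) * weight q 1 x * ‖z‖ ^ 2 := by
  set K : ℝ := (2 * q * (2 * (q + 1) + 1)) * 3 ^ q with hK
  have hK0 : 0 ≤ K := by positivity
  have hlip : ∀ y₁ ∈ Metric.closedBall x 1, ∀ y₂ ∈ Metric.closedBall x 1,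
      ‖weightDeriv q 1 y₂ z - weightDeriv q 1 y₁ z‖ ≤ (K * weight q 1 x * ‖z‖) * ‖y₂ - y₁‖ := by
    intro y₁ h₁ y₂ h₂
    refine (convex_closedBall x 1).norm_image_sub_le_of_norm_fderiv_le (𝕜 := ℝ)
      (f := fun y => weightDeriv q 1 y z)
      (fun y _ => differentiable_weightDeriv zero_le_one z y) (fun y hy => ?_) h₁ h₂
    have hw := (weight_pos (q := q) zero_le_one x).le
    refine ContinuousLinearMap.opNorm_le_bound _ (by positivity) fun v => ?_
    rw [fderiv_weightDeriv zero_le_one, Real.norm_eq_abs]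
    refine (abs_weightHess_le hq zero_le_one y z v).trans ?_
    have hyw : weight q 1 y ≤ 3 ^ q * weight q 1 x :=
      weight_le_of_norm_sub_le_one hq (by rw [← dist_eq_norm, dist_comm]; exact hy)
    calc _ ≤ (2 * q * (2 * (q + 1) + 1)) * 1 * (3 ^ q * weight q 1 x) * ‖z‖ * ‖v‖ := by gcongr
      _ = _ := by rw [hK]; ring
  have hd : ∀ τ ∈ Icc (0 : ℝ) 1, HasDerivWithinAt
      (fun τ : ℝ => weight q 1 (x - τ • z) + weight q 1 (x + τ • z))
      (weightDeriv q 1 (x + τ • z) z - weightDeriv q 1 (x - τ • z) z) (Icc 0 1) τ := by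
    intro τ _
    have l1 : HasDerivAt (fun τ : ℝ => x - τ • z) (-z) τ := by
      simpa using ((hasDerivAt_id τ).smul_const z).const_sub x
    have l2 : HasDerivAt (fun τ : ℝ => x + τ • z) z τ := by
      simpa using ((hasDerivAt_id τ).smul_const z).const_add x
    have d1 := (differentiable_weight (q := q) zero_le_one (x - τ • z)).hasFDerivAt.comp_hasDerivAt
      τ l1
    have d2 := (differentiable_weight (q := q) zero_le_one (x + τ • z)).hasFDerivAt.comp_hasDerivAt
      τ l2
    rw [map_neg, fderiv_weight zero_le_one] at d1
    rw [fderiv_weight zero_le_one] at d2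
    exact ((d1.add d2).congr_deriv (by ring)).hasDerivWithinAt
  have := norm_image_sub_le_of_norm_deriv_le_segment_01' hd
    (C := (K * weight q 1 x * ‖z‖) * (2 * ‖z‖)) (fun τ hτ => by
      have hw := (weight_pos (q := q) zero_le_one x).le
      have hτz : ‖τ • z‖ ≤ 1 := by
        rw [norm_smul, Real.norm_of_nonneg hτ.1]
        nlinarith [hτ.2, hτ.1, norm_nonneg z]
      refine (hlip (x - τ • z) (by simpa [Metric.mem_closedBall, dist_eq_norm] using hτz)
        (x + τ • z) (by simpa [Metric.mem_closedBall, dist_eq_norm] using hτz)).trans ?_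
      gcongr
      rw [show x + τ • z - (x - τ • z) = (2 * τ) • z by module, norm_smul, Real.norm_of_nonneg
        (by linarith [hτ.1])]
      gcongr
      linarith [hτ.2])
  simp only [one_smul, zero_smul, sub_zero, add_zero] at this
  rw [abs_sub_comm, ← abs_neg]
  rw [Real.norm_eq_abs] at this
  calc _ = |weight q 1 (x - z) + weight q 1 (x + z) - (weight q 1 x + weight q 1 x)| := by
        rw [← abs_neg]; congr 1; ring
    _ ≤ _ := this
    _ = _ := by ring

/-- In polar coordinates the integrand is `r^(1 - 2s)`, which is integrable at zero because `s < 1`.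
-/
theorem integrable_indicator_ball_rpow (hn : 1 ≤ n) (hs1 : s < 1) :
    Integrable ((Metric.ball (0 : E n) 1).indicator fun z => ‖z‖ ^ (2 - ((n : ℝ) + 2 * s))) := by
  rw [integrable_indicator_iff Metric.isOpen_ball.measurableSet]
  have : Nonempty (Fin n) := ⟨⟨0, hn⟩⟩
  have : Nontrivial (E n) := inferInstance
  refine (integrableOn_fun_norm_addHaar (E := E n) volume
    (f := fun r : ℝ => r ^ (2 - ((n : ℝ) + 2 * s)))).2 ?_
  have h : IntegrableOn (fun y : ℝ => y ^ (1 - 2 * s)) (Ioo 0 1) :=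
    (intervalIntegral.integrableOn_Ioo_rpow_iff zero_lt_one).2 (by linarith)
  refine h.congr_fun (fun y hy => ?_) measurableSet_Ioo
  have : ((n - 1 : ℕ) : ℝ) = (n : ℝ) - 1 := by push_cast [Nat.cast_sub hn]; ring
  rw [finrank_euclideanSpace_fin, smul_eq_mul, ← Real.rpow_natCast, this, ← Real.rpow_add hy.1]
  ring_nf

/-- The symmetrized integrand of the fractional Laplacian of the weight of matching decay is
controlled by the weight itself. -/
theorem exists_integral_diffQuot_weight_le (hn : 1 ≤ n) (hs : 0 < s) (hs1 : s < 1) :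
    ∃ C : ℝ, 0 ≤ C ∧ ∀ x : E n, Integrable (diffQuot s (weight ((n : ℝ) / 2 + s) 1) x) ∧
      |∫ z, diffQuot s (weight ((n : ℝ) / 2 + s) 1) x z| ≤ C * weight ((n : ℝ) / 2 + s) 1 x := by
  set q : ℝ := (n : ℝ) / 2 + s with hqd
  have hq0 : 0 ≤ q := by positivity
  have hq : (n : ℝ) < 2 * q := by rw [hqd]; linarith
  set C₁ : ℝ := 2 * ((2 * q * (2 * (q + 1) + 1)) * 3 ^ q)
  set C₂ : ℝ := 2 ^ q * (2 + 2 * 4 ^ q)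
  have hC₁ : 0 ≤ C₁ := by positivity
  have hC₂ : 0 ≤ C₂ := by positivity
  set g : E n → ℝ := (Metric.ball (0 : E n) 1).indicator fun z => ‖z‖ ^ (2 - ((n : ℝ) + 2 * s))
  have hg : Integrable g := integrable_indicator_ball_rpow hn hs1
  have hw := integrable_weight_one hq
  have hw1 : ∀ x : E n, Integrable fun z => weight q 1 (x - z) := fun x => hw.comp_sub_left x
  have hw2 : ∀ x : E n, Integrable fun z => weight q 1 (x + z) := fun x => hw.comp_add_left x
  -- A majorant with the weight at `x` factored out. Its `g` part handles `|z| < 1` through the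
  -- second difference; the three weights handle `|z| ≥ 1`. By translation invariance its integral
  -- in `z` is a constant times the weight at `x`.
  set H : E n → E n → ℝ := fun x z => weight q 1 x *
    (C₁ * g z + C₂ * (weight q 1 z + weight q 1 (x - z) + weight q 1 (x + z))) with hHd
  have hHi : ∀ x, Integrable (H x) := fun x =>
    ((hg.const_mul C₁).add (((hw.add (hw1 x)).add (hw2 x)).const_mul C₂)).const_mul _
  have hbound : ∀ x z, ‖diffQuot s (weight q 1) x z‖ ≤ H x z := by
    intro x z
    have w0 := (weight_pos (q := q) zero_le_one x).le
    have w1 := (weight_pos (q := q) zero_le_one z).le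
    have w2 := (weight_pos (q := q) zero_le_one (x - z)).le
    have w3 := (weight_pos (q := q) zero_le_one (x + z)).le
    rw [diffQuot, norm_div, Real.norm_eq_abs, Real.norm_of_nonneg (by positivity)]
    by_cases hz : ‖z‖ < 1
    · have hgz : g z = ‖z‖ ^ (2 - ((n : ℝ) + 2 * s)) :=
        indicator_of_mem (mem_ball_zero_iff.2 hz) _
      have h2 : |2 * weight q 1 x - weight q 1 (x - z) - weight q 1 (x + z)|
          / ‖z‖ ^ ((n : ℝ) + 2 * s) ≤ weight q 1 x * (C₁ * g z) := by
        rcases eq_or_ne z 0 with rfl | hz0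
        · simp only [sub_zero, add_zero]
          rw [show 2 * weight q 1 x - weight q 1 x - weight q 1 x = 0 by ring, abs_zero, zero_div,
            hgz]
          positivity
        · have hzp := norm_pos_iff.2 hz0
          rw [div_le_iff₀ (by positivity), hgz, Real.rpow_sub hzp, Real.rpow_two]
          refine (abs_weight_secondDiff_le hq0 hz.le).trans_eq ?_
          simp only [C₁]
          field_simp
      refine h2.trans ?_
      rw [hHd]
      dsimp only
      gcongr
      exact le_add_of_nonneg_right (by positivity)
    · have hz' : 1 ≤ ‖z‖ := not_lt.1 hz
      have hk := inv_rpow_norm_le_weight hq0 one_pos hz'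
      rw [show (1 : ℝ) + (1 ^ 2)⁻¹ = 2 by norm_num, show 2 * q = (n : ℝ) + 2 * s by rw [hqd]; ring]
        at hk
      have hgz : g z = 0 := indicator_of_notMem (by simpa using hz') _
      have m1 := weight_mul_weight_le hq0 x z
      have m2 := weight_mul_weight_le hq0 x (-z)
      rw [sub_neg_eq_add, weight_neg] at m2
      have habs : |2 * weight q 1 x - weight q 1 (x - z) - weight q 1 (x + z)|
          ≤ 2 * weight q 1 x + weight q 1 (x - z) + weight q 1 (x + z) := by
        rw [abs_le]; constructor <;> linarith
      have h4 : (0 : ℝ) ≤ 4 ^ q := by positivity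
      calc _ ≤ (2 * weight q 1 x + weight q 1 (x - z) + weight q 1 (x + z))
              * (1 / ‖z‖ ^ ((n : ℝ) + 2 * s)) := by
            rw [mul_one_div]; gcongr
        _ ≤ (2 * weight q 1 x + weight q 1 (x - z) + weight q 1 (x + z))
              * (2 ^ q * weight q 1 z) := by gcongr
        _ = 2 ^ q * (2 * weight q 1 x * weight q 1 z + weight q 1 (x - z) * weight q 1 z
              + weight q 1 (x + z) * weight q 1 z) := by ring
        _ ≤ 2 ^ q * (2 * weight q 1 x * weight q 1 z
              + 4 ^ q * weight q 1 x * (weight q 1 (x - z) + weight q 1 z)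
              + 4 ^ q * weight q 1 x * (weight q 1 (x + z) + weight q 1 z)) := by gcongr
        _ = 2 ^ q * weight q 1 x * ((2 + 2 * 4 ^ q) * weight q 1 z
              + 4 ^ q * weight q 1 (x - z) + 4 ^ q * weight q 1 (x + z)) := by ring
        _ ≤ 2 ^ q * weight q 1 x * ((2 + 2 * 4 ^ q) * weight q 1 z
              + (2 + 2 * 4 ^ q) * weight q 1 (x - z) + (2 + 2 * 4 ^ q) * weight q 1 (x + z)) := by
            gcongr <;> linarith
        _ = H x z := by rw [hHd]; dsimp only; rw [hgz]; ring
  have hmeas : ∀ x : E n, AEStronglyMeasurable (diffQuot s (weight q 1) x) volume := by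
    intro x
    have := (continuous_weight (n := n) (q := q) zero_le_one).measurable
    unfold diffQuot
    exact Measurable.aestronglyMeasurable (by fun_prop)
  refine ⟨C₁ * (∫ z, g z) + C₂ * (3 * ∫ z : E n, weight q 1 z), ?_, fun x => ⟨?_, ?_⟩⟩
  · have i1 : 0 ≤ ∫ z, g z := integral_nonneg fun z => indicator_nonneg (fun _ _ => by positivity) _
    have i2 : 0 ≤ ∫ z : E n, weight q 1 z :=
      integral_nonneg fun z => (weight_pos zero_le_one z).le
    positivity
  · exact (hHi x).mono' (hmeas x) (Eventually.of_forall (hbound x))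
  · refine (norm_integral_le_of_norm_le (hHi x) (Eventually.of_forall (hbound x))).trans_eq ?_
    rw [hHd]
    dsimp only
    have a1 : Integrable fun z => weight q 1 z + weight q 1 (x - z) := hw.add (hw1 x)
    have a2 : Integrable fun z => weight q 1 z + weight q 1 (x - z) + weight q 1 (x + z) :=
      a1.add (hw2 x)
    rw [integral_const_mul, integral_add (hg.const_mul C₁) (a2.const_mul C₂), integral_const_mul,
      integral_const_mul, integral_add a1 (hw2 x), integral_add hw (hw1 x),
      integral_sub_left_eq_self (weight q 1) volume x,
      integral_add_left_eq_self (weight q 1) x]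
    ring

/-- Pointwise bound `|(-Δ)^s w| ≤ C b^{2s} w` for the multiples `w` of the weight scaled by `b`. -/
theorem exists_abs_fracLaplacian_weight_le (hn : 1 ≤ n) (hs : 0 < s) (hs1 : s < 1) :
    ∃ C : ℝ, 0 ≤ C ∧ ∀ b : ℝ, 0 < b → ∀ (c : ℝ) (x : E n),
      |fracLaplacian s (fun y => c * weight ((n : ℝ) / 2 + s) (b ^ 2) y) x|
        ≤ C * b ^ (2 * s) * |c| * weight ((n : ℝ) / 2 + s) (b ^ 2) x := by
  obtain ⟨C, hC, h⟩ := exists_integral_diffQuot_weight_le hn hs hs1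
  set q : ℝ := (n : ℝ) / 2 + s with hqd
  have hq0 : 0 ≤ q := by positivity
  refine ⟨|fracConst n s| * (2⁻¹ * C), by positivity, fun b hb c x => ?_⟩
  -- Reduction to scale one: the kernel contributes `b^(n+2s)` and the change of variables `z ↦ b z`
  -- contributes `b^(-n)`, which leaves `b^(2s)`.
  have hscale : diffQuot s (fun y => c * weight q (b ^ 2) y) x
      = fun z => (c * b ^ ((n : ℝ) + 2 * s)) * diffQuot s (weight q 1) (b • x) (b • z) := by
    ext z
    simp only [diffQuot, ← smul_sub, ← smul_add, weight_smul, norm_smul, Real.norm_of_nonneg hb.le]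
    rw [Real.mul_rpow hb.le (norm_nonneg z)]
    have : b ^ ((n : ℝ) + 2 * s) ≠ 0 := (Real.rpow_pos_of_pos hb _).ne'
    field_simp
  have hint : Integrable (diffQuot s (fun y => c * weight q (b ^ 2) y) x) := by
    rw [hscale]
    exact ((h (b • x)).1.comp_smul hb.ne').const_mul _
  have hM : ∀ y : E n, |c * weight q (b ^ 2) y| ≤ |c| := fun y => by
    rw [abs_mul, abs_of_pos (weight_pos (sq_nonneg b) y)]
    exact mul_le_of_le_one_right (abs_nonneg c) (weight_le_one hq0 (sq_nonneg b) y)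
  rw [fracLaplacian_eq_integral hs ((continuous_weight (sq_nonneg b)).const_mul c) hM x hint,
    hscale, integral_const_mul, Measure.integral_comp_smul, finrank_euclideanSpace_fin, smul_eq_mul,
    abs_mul, abs_mul, abs_mul, abs_mul, abs_mul, abs_abs, abs_of_pos (show (0 : ℝ) < 2⁻¹ by norm_num),
    abs_of_pos (show 0 < (b ^ n)⁻¹ by positivity), abs_of_pos (Real.rpow_pos_of_pos hb _),
    Real.rpow_add hb, Real.rpow_natCast]
  calc _ = |fracConst n s| * 2⁻¹ * |c| * b ^ (2 * s)
        * |∫ z, diffQuot s (weight q 1) (b • x) z| := by field_simp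
    _ ≤ |fracConst n s| * 2⁻¹ * |c| * b ^ (2 * s) * (C * weight q 1 (b • x)) := by
        gcongr
        exact (h (b • x)).2
    _ = _ := by rw [weight_smul]; ring

/-- The fractional Laplacian at `x` depends only on the value at `x` and the values almost
everywhere. -/
theorem fracLaplacian_congr_ae {v w : E n → ℝ} (h : v =ᵐ[volume] w) {x : E n} (hx : v x = w x) :
    fracLaplacian s v x = fracLaplacian s w x := by
  unfold fracLaplacian
  congr 1
  ext ε
  congr 1
  refine integral_congr_ae (ae_restrict_of_ae (h.mono fun y hy => ?_))
  simp only [hx, hy]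

end fractional

/-! ### The cutoff in time and its tail integral. -/

section cutoff

theorem exists_abs_deriv_smoothTransition_le :
    ∃ D : ℝ, 0 ≤ D ∧ ∀ x, |deriv Real.smoothTransition x| ≤ D := by
  have hc : Continuous (deriv Real.smoothTransition) :=
    (Real.smoothTransition.contDiff (n := 1)).continuous_deriv le_rfl
  obtain ⟨D, hD⟩ := isCompact_Icc.exists_bound_of_continuousOn (s := Icc (0 : ℝ) 1) hc.continuousOn
  have hD0 : 0 ≤ D := (norm_nonneg _).trans (hD 0 (by simp))
  refine ⟨D, hD0, fun x => ?_⟩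
  rcases lt_or_ge x 0 with hx | hx
  · have : Real.smoothTransition =ᶠ[𝓝 x] fun _ => 0 := by
      filter_upwards [Iio_mem_nhds hx] with y hy
      exact Real.smoothTransition.zero_of_nonpos (le_of_lt hy)
    simpa [this.deriv_eq] using hD0
  rcases lt_or_ge 1 x with hx1 | hx1
  · have : Real.smoothTransition =ᶠ[𝓝 x] fun _ => 1 := by
      filter_upwards [Ioi_mem_nhds hx1] with y hy
      exact Real.smoothTransition.one_of_one_le (le_of_lt hy)
    simpa [this.deriv_eq] using hD0
  exact hD x ⟨hx, hx1⟩

/-- A smooth nonincreasing cutoff in time, equal to `1` on `(-∞, T]` and to `0` on `[2T, ∞)`. -/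
noncomputable def cutoff (k : ℕ) (T t : ℝ) : ℝ := Real.smoothTransition (2 - t / T) ^ k

/-- The primitive of `-cutoff` that vanishes on `[2T, ∞)`. -/
noncomputable def cutoffTail (k : ℕ) (T t : ℝ) : ℝ := ∫ τ in t..(2 * T), cutoff k T τ

variable {k : ℕ} {T : ℝ}

theorem contDiff_cutoff : ContDiff ℝ ∞ (cutoff k T) := by
  unfold cutoff
  refine ContDiff.pow ?_ k
  exact (Real.smoothTransition.contDiff (n := ⊤)).comp
    (contDiff_const.sub (contDiff_id.div_const T))

theorem cutoff_nonneg (t : ℝ) : 0 ≤ cutoff k T t := pow_nonneg (Real.smoothTransition.nonneg _) k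

theorem cutoff_le_one (t : ℝ) : cutoff k T t ≤ 1 :=
  pow_le_one₀ (Real.smoothTransition.nonneg _) (Real.smoothTransition.le_one _)

theorem cutoff_eq_one (hT : 0 < T) {t : ℝ} (ht : t ≤ T) : cutoff k T t = 1 := by
  have : t / T ≤ 1 := (div_le_one hT).2 ht
  rw [cutoff, Real.smoothTransition.one_of_one_le (by linarith), one_pow]

theorem cutoff_eq_zero (hk : k ≠ 0) (hT : 0 < T) {t : ℝ} (ht : 2 * T ≤ t) : cutoff k T t = 0 := by
  have : 2 ≤ t / T := (le_div_iff₀ hT).2 ht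
  rw [cutoff, Real.smoothTransition.zero_of_nonpos (by linarith), zero_pow hk]

theorem cutoff_antitone (hT : 0 < T) : Antitone (cutoff k T) := fun s t hst => by
  unfold cutoff
  have := Real.smoothTransition.nonneg (2 - t / T)
  gcongr
  exact Real.smoothTransition.monotone (by gcongr)

/-- Differentiating a `k`-th power leaves the power `k - 1`, and `k - 1 ≥ k/p` is the hypothesis on
`k`. The factor `η^(1/p)` is what Young's inequality needs to absorb the term into `η |u_t|^p`. -/
theorem exists_abs_deriv_cutoff_le {p : ℝ} (hp : 1 < p) (hk : p / (p - 1) ≤ k) :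
    ∃ C : ℝ, 0 ≤ C ∧ ∀ T : ℝ, 0 < T → ∀ t : ℝ,
      |deriv (cutoff k T) t| ≤ C / T * cutoff k T t ^ (1 / p) := by
  obtain ⟨D, hD0, hD⟩ := exists_abs_deriv_smoothTransition_le
  refine ⟨k * D, by positivity, fun T hT t => ?_⟩
  set y := 2 - t / T with hy
  have hS0 := Real.smoothTransition.nonneg y
  have hd : HasDerivAt (cutoff k T) (k * Real.smoothTransition y ^ (k - 1)
      * (deriv Real.smoothTransition y * (-(1 / T)))) t := by
    have h1 : HasDerivAt (fun t : ℝ => 2 - t / T) (-(1 / T)) t :=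
      ((hasDerivAt_id t).div_const T).const_sub 2
    have h2 : HasDerivAt Real.smoothTransition (deriv Real.smoothTransition y) y :=
      ((Real.smoothTransition.contDiff (n := 1)).differentiable (by simp) y).hasDerivAt
    exact (h2.comp t h1).pow k
  have hp1 : 0 < p - 1 := by linarith
  have hk1 : 1 < (k : ℝ) := lt_of_lt_of_le ((one_lt_div hp1).2 (by linarith)) hk
  have hkn : 1 < k := by exact_mod_cast hk1
  have hpow : Real.smoothTransition y ^ (k - 1) ≤ cutoff k T t ^ (1 / p) := by
    rw [cutoff, ← hy]
    rcases hS0.eq_or_lt with h0 | h0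
    · rw [← h0, zero_pow (by omega)]
      positivity
    · rw [← Real.rpow_natCast, ← Real.rpow_natCast, ← Real.rpow_mul h0.le]
      refine Real.rpow_le_rpow_of_exponent_ge h0 (Real.smoothTransition.le_one y) ?_
      rw [Nat.cast_sub hkn.le, mul_one_div, div_le_iff₀ (by linarith)]
      rw [div_le_iff₀ hp1] at hk
      push_cast
      linarith
  rw [hd.deriv, abs_mul, abs_mul, abs_mul, abs_neg, abs_of_nonneg (pow_nonneg hS0 _),
    abs_of_pos (show 0 < 1 / T by positivity), abs_of_nonneg (Nat.cast_nonneg k)]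
  calc _ ≤ k * cutoff k T t ^ (1 / p) * (D * (1 / T)) := by
        have := cutoff_nonneg (k := k) (T := T) t
        gcongr
        exact hD y
    _ = _ := by ring

theorem hasDerivAt_cutoffTail (t : ℝ) :
    HasDerivAt (cutoffTail k T) (-cutoff k T t) t := by
  have hc : Continuous (cutoff k T) := contDiff_cutoff.continuous
  exact intervalIntegral.integral_hasDerivAt_left (hc.intervalIntegrable _ _)
    (hc.stronglyMeasurableAtFilter _ _) hc.continuousAt

theorem contDiff_cutoffTail : ContDiff ℝ ∞ (cutoffTail k T) := by
  rw [contDiff_infty_iff_deriv]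
  refine ⟨fun t => (hasDerivAt_cutoffTail t).differentiableAt, ?_⟩
  rw [show deriv (cutoffTail k T) = fun t => -cutoff k T t from
    funext fun t => (hasDerivAt_cutoffTail t).deriv]
  exact contDiff_cutoff.neg

theorem cutoffTail_eq_zero (hk : k ≠ 0) (hT : 0 < T) {t : ℝ} (ht : 2 * T ≤ t) :
    cutoffTail k T t = 0 := by
  rw [cutoffTail, intervalIntegral.integral_congr (g := fun _ => 0)]
  · simp
  · intro τ hτ
    rw [uIcc_of_ge ht] at hτ
    exact cutoff_eq_zero hk hT hτ.1

theorem cutoffTail_nonneg (hk : k ≠ 0) (hT : 0 < T) (t : ℝ) : 0 ≤ cutoffTail k T t := by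
  rcases le_total (2 * T) t with h | h
  · rw [cutoffTail_eq_zero hk hT h]
  · exact intervalIntegral.integral_nonneg h fun τ _ => cutoff_nonneg τ

/-- The cutoff is nonincreasing and the remaining interval has length at most `2T`. Retaining the
factor `η` allows the Laplacian term to be absorbed like the others. -/
theorem cutoffTail_le (hk : k ≠ 0) (hT : 0 < T) {t : ℝ} (ht : 0 ≤ t) :
    cutoffTail k T t ≤ 2 * T * cutoff k T t := by
  rcases le_total (2 * T) t with h | h
  · rw [cutoffTail_eq_zero hk hT h, cutoff_eq_zero hk hT h, mul_zero]
  · have hc : Continuous (cutoff k T) := contDiff_cutoff.continuous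
    have h1 : cutoffTail k T t ≤ ∫ _ in t..(2 * T), cutoff k T t :=
      intervalIntegral.integral_mono_on h (hc.intervalIntegrable _ _)
        intervalIntegrable_const fun τ hτ => cutoff_antitone hT hτ.1
    rw [intervalIntegral.integral_const, smul_eq_mul] at h1
    have := cutoff_nonneg (k := k) (T := T) t
    nlinarith

end cutoff

/-! ### Weak time derivatives and the initial value. -/

section weakDerivative

/-- A smooth function that vanishes on `(-∞, δ/2]` and equals `1` on `[δ, ∞)`. -/
noncomputable def switchOn (δ t : ℝ) : ℝ := Real.smoothTransition (2 * t / δ - 1)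

variable {δ : ℝ}

theorem contDiff_switchOn : ContDiff ℝ ∞ (switchOn δ) := by
  unfold switchOn
  exact (Real.smoothTransition.contDiff (n := ⊤)).comp
    (((contDiff_const.mul contDiff_id).div_const δ).sub contDiff_const)

theorem switchOn_eq_zero (hδ : 0 < δ) {t : ℝ} (ht : t ≤ δ / 2) : switchOn δ t = 0 := by
  refine Real.smoothTransition.zero_of_nonpos ?_
  have : 2 * t / δ ≤ 1 := (div_le_one hδ).2 (by linarith)
  linarith

theorem switchOn_eq_one (hδ : 0 < δ) {t : ℝ} (ht : δ ≤ t) : switchOn δ t = 1 := by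
  refine Real.smoothTransition.one_of_one_le ?_
  have : 2 ≤ 2 * t / δ := (le_div_iff₀ hδ).2 (by linarith)
  linarith

theorem switchOn_monotone (hδ : 0 < δ) : Monotone (switchOn δ) := fun s t hst =>
  Real.smoothTransition.monotone (by gcongr)

theorem abs_switchOn_le (t : ℝ) : |switchOn δ t| ≤ 1 := by
  rw [switchOn, abs_of_nonneg (Real.smoothTransition.nonneg _)]
  exact Real.smoothTransition.le_one _

theorem deriv_switchOn_nonneg (hδ : 0 < δ) (t : ℝ) : 0 ≤ deriv (switchOn δ) t :=
  (switchOn_monotone hδ).deriv_nonneg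

theorem deriv_switchOn_eq_zero (hδ : 0 < δ) {t : ℝ} (ht : t ∉ Icc (δ / 2) δ) :
    deriv (switchOn δ) t = 0 := by
  rw [mem_Icc, not_and_or, not_le, not_le] at ht
  rcases ht with ht | ht
  · have : switchOn δ =ᶠ[𝓝 t] fun _ => 0 := by
      filter_upwards [Iio_mem_nhds ht] with y hy
      exact switchOn_eq_zero hδ (le_of_lt hy)
    simp [this.deriv_eq]
  · have : switchOn δ =ᶠ[𝓝 t] fun _ => 1 := by
      filter_upwards [Ioi_mem_nhds ht] with y hy
      exact switchOn_eq_one hδ (le_of_lt hy)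
    simp [this.deriv_eq]

theorem continuous_deriv_switchOn : Continuous (deriv (switchOn δ)) :=
  contDiff_switchOn.continuous_deriv (by simp)

theorem integral_deriv_switchOn (hδ : 0 < δ) : ∫ t in Icc (δ / 2) δ, deriv (switchOn δ) t = 1 := by
  rw [integral_Icc_eq_integral_Ioc, ← intervalIntegral.integral_of_le (by linarith),
    intervalIntegral.integral_deriv_eq_sub
      (fun t _ => (contDiff_switchOn (δ := δ)).differentiable (by simp) t)
      (continuous_deriv_switchOn.intervalIntegrable _ _),
    switchOn_eq_one hδ le_rfl, switchOn_eq_zero hδ le_rfl, sub_zero]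

theorem integrable_deriv_switchOn_mul {f : ℝ → ℝ} (hf : LocallyIntegrableOn f (Ioi 0))
    (hδ : 0 < δ) : Integrable fun t => deriv (switchOn δ) t * f t := by
  have hsub : Icc (δ / 2) δ ⊆ Ioi 0 := fun t ht => (half_pos hδ).trans_le ht.1
  rw [← integrableOn_iff_integrable_of_support_subset (s := Icc (δ / 2) δ)]
  · exact ((hf.integrableOn_compact_subset hsub isCompact_Icc)).continuousOn_mul
      continuous_deriv_switchOn.continuousOn isCompact_Icc
  · intro t ht
    by_contra h
    exact ht (by simp [deriv_switchOn_eq_zero hδ h])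

/-- Averages over shrinking intervals near `0` converge to the essential limit at `0+`. -/
theorem tendsto_integral_deriv_switchOn_mul {f : ℝ → ℝ} {c : ℝ}
    (hf : LocallyIntegrableOn f (Ioi 0)) (hlim : Tendsto f (𝓝[>] (0 : ℝ) ⊓ ae volume) (𝓝 c)) :
    Tendsto (fun δ => ∫ t in Ioi (0 : ℝ), deriv (switchOn δ) t * f t) (𝓝[>] 0) (𝓝 c) := by
  rw [Metric.tendsto_nhds]
  intro ε hε
  have hev := hlim (Metric.closedBall_mem_nhds c (half_pos hε))
  -- `A` is a right neighbourhood of `0` and `B` a set of full measure. For small `δ` almost every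
  -- point of `[δ/2, δ]` lies in both, and the derivative of `switchOn` is a probability density
  -- there.
  obtain ⟨A, hA, B, hB, hAB⟩ := mem_inf_iff.1 hev
  obtain ⟨δ₀, hδ₀, hsub⟩ := mem_nhdsGT_iff_exists_Ioo_subset.1 hA
  filter_upwards [Ioo_mem_nhdsGT hδ₀] with δ hδ
  have hpos : Icc (δ / 2) δ ⊆ Ioi 0 := fun t ht => (half_pos hδ.1).trans_le ht.1
  have hd : IntegrableOn (deriv (switchOn δ)) (Icc (δ / 2) δ) :=
    continuous_deriv_switchOn.continuousOn.integrableOn_compact isCompact_Icc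
  have hdf : IntegrableOn (fun t => deriv (switchOn δ) t * f t) (Icc (δ / 2) δ) :=
    (integrable_deriv_switchOn_mul hf hδ.1).integrableOn
  have e1 : ∫ t in Ioi (0 : ℝ), deriv (switchOn δ) t * f t
      = ∫ t in Icc (δ / 2) δ, deriv (switchOn δ) t * f t := by
    refine (setIntegral_eq_of_subset_of_forall_sdiff_eq_zero measurableSet_Ioi hpos ?_)
    intro t ht
    rw [deriv_switchOn_eq_zero hδ.1 ht.2, zero_mul]
  have e2 : (∫ t in Icc (δ / 2) δ, deriv (switchOn δ) t * f t) - c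
      = ∫ t in Icc (δ / 2) δ, deriv (switchOn δ) t * (f t - c) := by
    simp only [mul_sub]
    rw [integral_sub hdf (hd.mul_const c), integral_mul_const, integral_deriv_switchOn hδ.1,
      one_mul]
  rw [dist_eq_norm, e1, e2]
  have hb : ∀ᵐ t ∂volume.restrict (Icc (δ / 2) δ),
      ‖deriv (switchOn δ) t * (f t - c)‖ ≤ deriv (switchOn δ) t * (ε / 2) := by
    rw [ae_restrict_iff' measurableSet_Icc]
    filter_upwards [hB] with t htB ht
    have : t ∈ A ∩ B := ⟨hsub ⟨hpos ht, ht.2.trans_lt hδ.2⟩, htB⟩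
    rw [← hAB, mem_preimage, Metric.mem_closedBall, dist_eq_norm] at this
    rw [norm_mul, Real.norm_of_nonneg (deriv_switchOn_nonneg hδ.1 t)]
    exact mul_le_mul_of_nonneg_left this (deriv_switchOn_nonneg hδ.1 t)
  have := norm_integral_le_of_norm_le (hd.mul_const (ε / 2)) hb
  rw [integral_mul_const, integral_deriv_switchOn hδ.1, one_mul] at this
  linarith

theorem tendsto_integral_switchOn_mul {f : ℝ → ℝ} (hf : IntegrableOn f (Ioi 0)) :
    Tendsto (fun δ => ∫ t in Ioi (0 : ℝ), switchOn δ t * f t) (𝓝[>] 0)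
      (𝓝 (∫ t in Ioi (0 : ℝ), f t)) := by
  refine tendsto_integral_filter_of_dominated_convergence (fun t => ‖f t‖) ?_ ?_ hf.norm ?_
  · exact Eventually.of_forall fun δ =>
      contDiff_switchOn.continuous.aestronglyMeasurable.mul hf.aestronglyMeasurable
  · refine Eventually.of_forall fun δ => Eventually.of_forall fun t => ?_
    rw [norm_mul]
    exact mul_le_of_le_one_left (norm_nonneg _) (abs_switchOn_le t)
  · refine (ae_restrict_iff' measurableSet_Ioi).2 (Eventually.of_forall fun t ht => ?_)
    refine tendsto_const_nhds.congr' ?_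
    filter_upwards [Ioo_mem_nhdsGT (show (0 : ℝ) < t from ht)] with δ hδ
    rw [switchOn_eq_one hδ.1 hδ.2.le, one_mul]

/-- Integration by parts on `(0,∞)` for a function `f` with weak derivative `h` and essential limit
`c` at `0+`, against a smooth function `Θ` with bounded support. -/
theorem integral_mul_eq_of_weak_deriv {f h Θ η : ℝ → ℝ} {c T : ℝ}
    (hΘ : ContDiff ℝ ∞ Θ) (hderiv : ∀ t, HasDerivAt Θ (-η t) t) (hsupp : ∀ t, T ≤ t → Θ t = 0)
    (hweak : ∀ χ : ℝ → ℝ, ContDiff ℝ ∞ χ → HasCompactSupport χ → tsupport χ ⊆ Ioi 0 →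
      ∫ t in Ioi (0 : ℝ), deriv χ t * f t = -∫ t in Ioi (0 : ℝ), χ t * h t)
    (hf : LocallyIntegrableOn f (Ioi 0)) (hηf : IntegrableOn (fun t => η t * f t) (Ioi 0))
    (hΘh : IntegrableOn (fun t => Θ t * h t) (Ioi 0))
    (hlim : Tendsto f (𝓝[>] (0 : ℝ) ⊓ ae volume) (𝓝 c)) :
    ∫ t in Ioi (0 : ℝ), η t * f t = Θ 0 * c + ∫ t in Ioi (0 : ℝ), Θ t * h t := by
  have hΘf : LocallyIntegrableOn (fun t => Θ t * f t) (Ioi 0) :=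
    hf.continuousOn_mul hΘ.continuous.continuousOn isOpen_Ioi.isLocallyClosed
  have hlim' : Tendsto (fun t => Θ t * f t) (𝓝[>] (0 : ℝ) ⊓ ae volume) (𝓝 (Θ 0 * c)) :=
    ((hΘ.continuous.tendsto 0).mono_left (inf_le_left.trans nhdsWithin_le_nhds)).mul hlim
  -- `Θ · switchOn δ` is supported in `[δ/2, T]`, hence admissible for the weak derivative. As `δ →
  -- 0` the derivative of the switch produces the boundary value `Θ(0) c`.
  have key : ∀ δ : ℝ, 0 < δ →
      -(∫ t in Ioi (0 : ℝ), switchOn δ t * (η t * f t))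
        + ∫ t in Ioi (0 : ℝ), deriv (switchOn δ) t * (Θ t * f t)
      = -∫ t in Ioi (0 : ℝ), switchOn δ t * (Θ t * h t) := by
    intro δ hδ
    have hsub : tsupport (fun t => Θ t * switchOn δ t) ⊆ Icc (δ / 2) T := by
      refine closure_minimal (fun t ht => ?_) isClosed_Icc
      rw [Function.mem_support] at ht
      refine ⟨?_, ?_⟩
      · by_contra hlt
        exact ht (by rw [switchOn_eq_zero hδ (not_le.1 hlt).le, mul_zero])
      · by_contra hlt
        exact ht (by rw [hsupp t (not_le.1 hlt).le, zero_mul])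
    have hw := hweak (fun t => Θ t * switchOn δ t) (hΘ.mul contDiff_switchOn)
      (isCompact_Icc.of_isClosed_subset (isClosed_tsupport _) hsub)
      (hsub.trans fun t ht => (half_pos hδ).trans_le ht.1)
    have hd : ∀ t, deriv (fun t => Θ t * switchOn δ t) t
        = -η t * switchOn δ t + Θ t * deriv (switchOn δ) t := fun t =>
      ((hderiv t).mul (((contDiff_switchOn (δ := δ)).differentiable (by simp) t).hasDerivAt)).deriv
    have i1 : IntegrableOn (fun t => switchOn δ t * (η t * f t)) (Ioi 0) :=
      Integrable.bdd_mul (c := 1) hηf contDiff_switchOn.continuous.aestronglyMeasurable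
        (Eventually.of_forall fun t => abs_switchOn_le t)
    have i2 : IntegrableOn (fun t => deriv (switchOn δ) t * (Θ t * f t)) (Ioi 0) :=
      (integrable_deriv_switchOn_mul hΘf hδ).integrableOn
    have e1 : ∫ t in Ioi (0 : ℝ), switchOn δ t * (Θ t * h t)
        = ∫ t in Ioi (0 : ℝ), Θ t * switchOn δ t * h t := by
      congr 1; ext t; ring
    rw [e1, ← hw, neg_add_eq_sub, ← integral_sub i2 i1]
    congr 1
    ext t
    rw [hd]
    ring
  have l1 := (tendsto_integral_switchOn_mul hηf).neg.add
    (tendsto_integral_deriv_switchOn_mul hΘf hlim')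
  have l2 := (tendsto_integral_switchOn_mul hΘh).neg
  have := tendsto_nhds_unique_of_eventuallyEq l1 l2 (by
    filter_upwards [self_mem_nhdsWithin] with δ hδ
    exact key δ hδ)
  linarith

end weakDerivative

/-! ### The product test function and its derivatives. -/

section testFunction

variable {n : ℕ} {q b T : ℝ} {k : ℕ}

theorem HasWeakPartial.const_smul {i : Fin n} {v w : L2 n} (h : HasWeakPartial i v w) (c : ℝ) :
    HasWeakPartial i (c • v) (c • w) := by
  intro χ hχ hc
  have e1 : ∫ x, (c • v) x * fderiv ℝ χ x (EuclideanSpace.single i 1)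
      = c * ∫ x, v x * fderiv ℝ χ x (EuclideanSpace.single i 1) := by
    rw [← integral_const_mul]
    refine integral_congr_ae ((Lp.coeFn_smul c v).mono fun x hx => ?_)
    simp only [hx, Pi.smul_apply, smul_eq_mul, mul_assoc]
  have e2 : ∫ x, (c • w) x * χ x = c * ∫ x, w x * χ x := by
    rw [← integral_const_mul]
    refine integral_congr_ae ((Lp.coeFn_smul c w).mono fun x hx => ?_)
    simp only [hx, Pi.smul_apply, smul_eq_mul, mul_assoc]
  rw [e1, e2, h χ hχ hc, mul_neg]

theorem memLp_weight (hq : (n : ℝ) < 2 * q) (hb : 0 < b) :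
    MemLp (weight q (b ^ 2) : E n → ℝ) 2 :=
  memLp_of_le_weight hq hb (C := 1) (continuous_weight (sq_nonneg b)).aestronglyMeasurable
    fun x => by rw [abs_of_pos (weight_pos (sq_nonneg b) x), one_mul]

theorem nonneg_of_natCast_lt (hq : (n : ℝ) < 2 * q) : 0 ≤ q := by
  have := n.cast_nonneg (α := ℝ)
  linarith

theorem memLp_weightDeriv (hq : (n : ℝ) < 2 * q) (hb : 0 < b) (z : E n) :
    MemLp (fun x => weightDeriv q (b ^ 2) x z) 2 :=
  memLp_of_le_weight hq hb (C := 2 * q * (1 + b ^ 2) * ‖z‖)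
    (continuous_weightDeriv (sq_nonneg b) z).aestronglyMeasurable
    fun x => (abs_weightDeriv_le (nonneg_of_natCast_lt hq) (sq_nonneg b) x z).trans_eq (by ring)

theorem memLp_weightHess (hq : (n : ℝ) < 2 * q) (hb : 0 < b) (z v : E n) :
    MemLp (fun x => weightHess q (b ^ 2) x z v) 2 :=
  memLp_of_le_weight hq hb (C := (2 * q * (2 * (q + 1) + 1)) * b ^ 2 * ‖z‖ * ‖v‖)
    (continuous_weightHess (sq_nonneg b) z v).aestronglyMeasurable
    fun x => (abs_weightHess_le (nonneg_of_natCast_lt hq) (sq_nonneg b) x z v).trans_eq (by ring)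

/-- The test function `cutoff(t) * weight(x)`. -/
noncomputable def cutoffWeight (hk : k ≠ 0) (hT : 0 < T) (hq : (n : ℝ) < 2 * q) (hb : 0 < b) :
    TestFunction n where
  val t := cutoff k T t • (memLp_weight hq hb).toLp _
  dt t := deriv (cutoff k T) t • (memLp_weight hq hb).toLp _
  grad i t := cutoff k T t • (memLp_weightDeriv hq hb (EuclideanSpace.single i 1)).toLp _
  hess i j t := cutoff k T t •
    (memLp_weightHess hq hb (EuclideanSpace.single i 1) (EuclideanSpace.single j 1)).toLp _
  hasWeakPartial_val _ _ i := (hasWeakPartial_of_differentiable i _ _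
    (differentiable_weight (sq_nonneg b)) fun x => fderiv_weight (sq_nonneg b) x _).const_smul _
  hasWeakPartial_grad _ _ i j := (hasWeakPartial_of_differentiable j _ _
    (differentiable_weightDeriv (sq_nonneg b) _)
    fun x => fderiv_weightDeriv (sq_nonneg b) x _ _).const_smul _
  continuousOn_val := (contDiff_cutoff.continuous.smul continuous_const).continuousOn
  continuousOn_grad _ := (contDiff_cutoff.continuous.smul continuous_const).continuousOn
  continuousOn_hess _ _ := (contDiff_cutoff.continuous.smul continuous_const).continuousOn
  hasDerivWithinAt_val t _ :=
    ((contDiff_cutoff.differentiable (by simp) t).hasDerivAt.smul_const _).hasDerivWithinAt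
  continuousOn_dt :=
    ((contDiff_cutoff.continuous_deriv (by simp)).smul continuous_const).continuousOn
  compactSupport := ⟨2 * T, fun t ht => by rw [cutoff_eq_zero hk hT ht, zero_smul]⟩

theorem coeFn_smul_toLp {f : E n → ℝ} (hf : MemLp f 2 volume) (c : ℝ) :
    (c • hf.toLp f : L2 n) =ᵐ[volume] fun x => c * f x := by
  filter_upwards [Lp.coeFn_smul c (hf.toLp f), hf.coeFn_toLp] with x h1 h2
  rw [h1, Pi.smul_apply, h2, smul_eq_mul]

theorem cutoffWeight_val (hk : k ≠ 0) (hT : 0 < T) (hq : (n : ℝ) < 2 * q) (hb : 0 < b)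
    (t : ℝ) : ((cutoffWeight hk hT hq hb).val t : E n → ℝ)
    =ᵐ[volume] fun x => cutoff k T t * weight q (b ^ 2) x :=
  coeFn_smul_toLp (memLp_weight hq hb) _

theorem cutoffWeight_dt (hk : k ≠ 0) (hT : 0 < T) (hq : (n : ℝ) < 2 * q) (hb : 0 < b)
    (t : ℝ) : ((cutoffWeight hk hT hq hb).dt t : E n → ℝ)
    =ᵐ[volume] fun x => deriv (cutoff k T) t * weight q (b ^ 2) x :=
  coeFn_smul_toLp (memLp_weight hq hb) _

/-- The Laplacian of the weight. -/
noncomputable def weightLaplacian (q a : ℝ) (x : E n) : ℝ :=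
  ∑ i, weightHess q a x (EuclideanSpace.single i 1) (EuclideanSpace.single i 1)

theorem memLp_weightLaplacian (hq : (n : ℝ) < 2 * q) (hb : 0 < b) :
    MemLp (weightLaplacian q (b ^ 2) : E n → ℝ) 2 :=
  memLp_finsetSum _ fun _ _ => memLp_weightHess hq hb _ _

theorem abs_weightLaplacian_le (hq : 0 ≤ q) {a : ℝ} (ha : 0 ≤ a) (x : E n) :
    |weightLaplacian q a x| ≤ (n * (2 * q * (2 * (q + 1) + 1))) * a * weight q a x := by
  refine (Finset.abs_sum_le_sum_abs _ _).trans ((Finset.sum_le_sum fun i _ =>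
    abs_weightHess_le hq ha x _ _).trans_eq ?_)
  simp
  ring

theorem cutoffWeight_laplacian (hk : k ≠ 0) (hT : 0 < T) (hq : (n : ℝ) < 2 * q) (hb : 0 < b)
    (t : ℝ) : ((cutoffWeight hk hT hq hb).laplacian t : E n → ℝ)
    =ᵐ[volume] fun x => cutoff k T t * weightLaplacian q (b ^ 2) x := by
  have h : (cutoffWeight hk hT hq hb).laplacian t
      = cutoff k T t • (memLp_weightLaplacian hq hb).toLp _ := by
    rw [TestFunction.laplacian]
    simp only [cutoffWeight]
    rw [← Finset.smul_sum]
    congr 1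
    apply Lp.ext
    filter_upwards [(memLp_weightLaplacian hq hb).coeFn_toLp,
      Lp.coeFn_finsetSum (s := Finset.univ) (f := fun i : Fin n => (memLp_weightHess hq hb
        (EuclideanSpace.single i 1) (EuclideanSpace.single i 1)).toLp _),
      ae_all_iff.2 fun i : Fin n => (memLp_weightHess hq hb
        (EuclideanSpace.single i 1) (EuclideanSpace.single i 1)).coeFn_toLp] with x h1 h2 h3
    rw [h1, h2, Finset.sum_apply, weightLaplacian]
    exact Finset.sum_congr rfl fun i _ => h3 i
  rw [h]
  exact coeFn_smul_toLp _ _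

/-- For `σ = 2` the bound comes from the explicit Laplacian, for `σ < 2` from the fractional
estimate. It holds only almost everywhere in `x`, namely where the `L²` representative agrees with
the weight. The constant does not depend on `T` and `b`. -/
theorem exists_abs_damping_cutoffWeight_le (hn : 1 ≤ n) {σ : ℝ} (hσ : 0 < σ) (hσ2 : σ ≤ 2)
    (hq : (n : ℝ) < 2 * ((n : ℝ) / 2 + σ / 2)) (hk : k ≠ 0) :
    ∃ C : ℝ, 0 ≤ C ∧ ∀ (T b : ℝ) (hT : 0 < T) (hb : 0 < b) (t : ℝ), ∀ᵐ x : E n,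
      |(cutoffWeight hk hT hq hb).damping σ t x|
        ≤ C * b ^ σ * cutoff k T t * weight ((n : ℝ) / 2 + σ / 2) (b ^ 2) x := by
  rcases hσ2.eq_or_lt with rfl | hlt
  · set q := (n : ℝ) / 2 + 2 / 2
    refine ⟨n * (2 * q * (2 * (q + 1) + 1)), by positivity, fun T b hT hb t => ?_⟩
    filter_upwards [cutoffWeight_laplacian hk hT hq hb t] with x hx
    rw [TestFunction.damping, if_pos rfl, abs_neg, hx, abs_mul, abs_of_nonneg (cutoff_nonneg t),
      Real.rpow_two]
    calc _ ≤ cutoff k T t * ((n * (2 * q * (2 * (q + 1) + 1))) * b ^ 2 * weight q (b ^ 2) x) := by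
          have := cutoff_nonneg (k := k) (T := T) t
          gcongr
          exact abs_weightLaplacian_le (by positivity) (sq_nonneg b) x
      _ = _ := by ring
  · obtain ⟨C, hC, h⟩ := exists_abs_fracLaplacian_weight_le hn (half_pos hσ)
      (show σ / 2 < 1 by linarith)
    refine ⟨C, hC, fun T b hT hb t => ?_⟩
    have hv := cutoffWeight_val hk hT hq hb t
    filter_upwards [hv] with x hx
    rw [TestFunction.damping, if_neg hlt.ne, fracLaplacian_congr_ae hv hx]
    refine (h b hb _ x).trans_eq ?_
    rw [abs_of_nonneg (cutoff_nonneg t), show 2 * (σ / 2) = σ by ring]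

end testFunction

/-! ### Young's inequality with a free parameter. -/

section young

/-- Either `c ≤ L u^(p-1)`, and the first term dominates, or `u ≤ (c/L)^(1/(p-1))`, and the second
does. No sharp constants are needed. -/
theorem mul_le_rpow_add_rpow {p L u c : ℝ} (hp : 1 < p) (hL : 0 < L) (hu : 0 ≤ u) (hc : 0 ≤ c) :
    u * c ≤ L * u ^ p + L ^ (-(1 / (p - 1))) * c ^ (p / (p - 1)) := by
  have hp1 : 0 < p - 1 := by linarith
  rcases hc.eq_or_lt with rfl | hc0
  · rw [mul_zero]; positivity
  rcases le_total u ((c / L) ^ (1 / (p - 1))) with h | h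
  · have e : (c / L) ^ (1 / (p - 1)) * c = L ^ (-(1 / (p - 1))) * c ^ (p / (p - 1)) := by
      rw [Real.div_rpow hc hL.le, Real.rpow_neg hL.le,
        show p / (p - 1) = 1 / (p - 1) + 1 by field_simp; ring, Real.rpow_add_one hc0.ne']
      ring
    have : u * c ≤ (c / L) ^ (1 / (p - 1)) * c := by gcongr
    have : 0 ≤ L * u ^ p := by positivity
    linarith
  · have hu0 : 0 < u := (Real.rpow_pos_of_pos (by positivity) _).trans_le h
    have h1 : c / L ≤ u ^ (p - 1) := by
      have := Real.rpow_le_rpow (by positivity) h hp1.le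
      rwa [← Real.rpow_mul (by positivity), one_div_mul_cancel hp1.ne', Real.rpow_one] at this
    have h2 : c ≤ L * u ^ (p - 1) := by rwa [div_le_iff₀' hL] at h1
    have h3 : u * c ≤ L * u ^ p := by
      rw [show p = (p - 1) + 1 by ring, Real.rpow_add_one hu0.ne']
      nlinarith
    have : 0 ≤ L ^ (-(1 / (p - 1))) * c ^ (p / (p - 1)) := by positivity
    linarith

theorem mul_integral_le_rpow_add {n : ℕ} {p L c : ℝ} (hp : 1 < p) (hL : 0 < L) (hc : 0 ≤ c)
    {v w : E n → ℝ} (hw : ∀ x, 0 ≤ w x) (hwi : Integrable w)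
    (hv : Integrable fun x => |v x| * w x) (hvp : Integrable fun x => |v x| ^ p * w x) :
    c * ∫ x, |v x| * w x ≤ L * (∫ x, |v x| ^ p * w x)
      + L ^ (-(1 / (p - 1))) * c ^ (p / (p - 1)) * ∫ x, w x := by
  rw [← integral_const_mul, ← integral_const_mul, ← integral_const_mul,
    ← integral_add (hvp.const_mul L) (hwi.const_mul _)]
  refine integral_mono (hv.const_mul c) ((hvp.const_mul L).add (hwi.const_mul _)) fun x => ?_
  have := mul_le_mul_of_nonneg_right (mul_le_rpow_add_rpow hp hL (abs_nonneg (v x)) hc) (hw x)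
  dsimp only [Pi.add_apply]
  linarith

end young

/-! ### Integrability of `|u_t|^p` for almost every time. -/

section measurability

variable {n : ℕ}

/-- Fatou along an almost everywhere convergent subsequence. Lower semicontinuity makes these norms
Borel functions on `L²`. -/
theorem lowerSemicontinuous_eLpNorm (r : ENNReal) :
    LowerSemicontinuous fun v : L2 n => eLpNorm v r volume := by
  rw [lowerSemicontinuous_iff_isClosed_preimage]
  intro y
  refine IsSeqClosed.isClosed fun v w hv hvw => ?_
  obtain ⟨ns, -, hns⟩ := (tendstoInMeasure_of_tendsto_Lp hvw).exists_seq_tendsto_ae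
  refine (Lp.eLpNorm_lim_le_liminf_eLpNorm (fun j => Lp.aestronglyMeasurable (v (ns j))) w hns).trans
    ?_
  exact (liminf_le_liminf (Eventually.of_forall fun j => hv (ns j))).trans_eq
    (liminf_const y)

/-- A measurable function with finite integral is finite almost everywhere; the half-line is
exhausted by the intervals `[1/(j+1), j+1]`. -/
theorem ae_eLpNorm_lt_top {ut : ℝ → L2 n} {p : ℝ} {r : ENNReal} (hp : 0 < p)
    (hmeas : LocallyIntegrableOn ut (Ioi 0))
    (h : ∀ K : Set ℝ, IsCompact K → K ⊆ Ioi 0 → ∫⁻ t in K, (eLpNorm (ut t) r volume) ^ p < ⊤) :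
    ∀ᵐ t ∂volume.restrict (Ioi (0 : ℝ)), eLpNorm (ut t) r volume < ⊤ := by
  have hU : (⋃ j : ℕ, Icc ((1 : ℝ) / (j + 1)) (j + 1)) = Ioi 0 := by
    ext t
    simp only [mem_iUnion, mem_Icc, mem_Ioi]
    constructor
    · rintro ⟨j, hj, -⟩
      exact lt_of_lt_of_le (by positivity) hj
    · intro ht
      obtain ⟨i, hi⟩ := exists_nat_one_div_lt ht
      obtain ⟨j, hj⟩ := exists_nat_gt t
      refine ⟨max i j, ?_, ?_⟩
      · refine le_trans ?_ hi.le
        gcongr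
        exact le_max_left _ _
      · have : (j : ℝ) ≤ ((max i j : ℕ) : ℝ) := by exact_mod_cast le_max_right i j
        linarith
  rw [← hU, ae_restrict_iUnion_iff]
  intro j
  have hsub : Icc ((1 : ℝ) / (j + 1)) (j + 1) ⊆ Ioi 0 := fun t ht =>
    lt_of_lt_of_le (by positivity) ht.1
  have hm : AEMeasurable (fun t => (eLpNorm (ut t) r volume) ^ p)
      (volume.restrict (Icc ((1 : ℝ) / (j + 1)) (j + 1))) := by
    let _ : MeasurableSpace (L2 n) := borel _
    have : BorelSpace (L2 n) := ⟨rfl⟩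
    have h1 := (hmeas.integrableOn_compact_subset hsub isCompact_Icc).aestronglyMeasurable
    exact ((lowerSemicontinuous_eLpNorm r).measurable.comp_aemeasurable
      h1.aemeasurable).pow_const p
  filter_upwards [ae_lt_top' hm (h _ isCompact_Icc hsub).ne] with t ht
  exact (ENNReal.rpow_lt_top_iff_of_pos hp).1 ht

theorem memLp_abs_rpow {v : L2 n} {p : ℝ} (hp : 0 < p)
    (h : eLpNorm v (ENNReal.ofReal (2 * p)) volume < ⊤) :
    MemLp (fun x => |v x| ^ p) 2 volume := by
  have h1 : MemLp v (ENNReal.ofReal (2 * p)) volume := ⟨Lp.aestronglyMeasurable v, h⟩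
  have h2 := h1.norm_rpow_div (ENNReal.ofReal p)
  have e : ENNReal.ofReal (2 * p) / ENNReal.ofReal p = 2 := by
    rw [← ENNReal.ofReal_div_of_pos hp, mul_div_cancel_right₀ _ hp.ne']
    simp
  rw [e, ENNReal.toReal_ofReal hp.le] at h2
  exact h2

end measurability

/-! ### Weighted integrals at a fixed time. -/

variable {n : ℕ}

/-- The weighted `L^p` quantity `∫ |v|^p w` of `v` with `w = weight q (b²)`. -/
noncomputable def weightedPower (p q b : ℝ) (v : L2 n) : ℝ := ∫ x, |v x| ^ p * weight q (b ^ 2) x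

/-- The weighted `L¹` quantity `∫ |v| w` of `v` with `w = weight q (b²)`. -/
noncomputable def weightedMass (q b : ℝ) (v : L2 n) : ℝ := ∫ x, |v x| * weight q (b ^ 2) x

section weighted

variable {p q b b₀ : ℝ} {v : L2 n}

theorem weightedPower_nonneg : 0 ≤ weightedPower p q b v :=
  integral_nonneg fun x => mul_nonneg (by positivity) (weight_pos (sq_nonneg b) x).le

theorem weightedMass_nonneg : 0 ≤ weightedMass q b v :=
  integral_nonneg fun x => mul_nonneg (abs_nonneg _) (weight_pos (sq_nonneg b) x).le

theorem integrable_abs_mul_weight (hq : (n : ℝ) < 2 * q) (hb : 0 < b) :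
    Integrable fun x => |v x| * weight q (b ^ 2) x :=
  MemLp.integrable_mul (Lp.memLp v).abs (memLp_weight hq hb)

theorem integrable_rpow_mul_weight (hq : (n : ℝ) < 2 * q) (hb : 0 < b)
    (hv : MemLp (fun x => |v x| ^ p) 2 volume) :
    Integrable fun x => |v x| ^ p * weight q (b ^ 2) x :=
  hv.integrable_mul (memLp_weight hq hb)

theorem abs_integral_mul_le (hq : (n : ℝ) < 2 * q) (hb : 0 < b) {g : E n → ℝ} {C : ℝ}
    (hg : ∀ᵐ x, |g x| ≤ C * weight q (b ^ 2) x) :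
    |∫ x, v x * g x| ≤ C * weightedMass q b v := by
  rw [weightedMass, ← integral_const_mul, ← Real.norm_eq_abs]
  refine norm_integral_le_of_norm_le ((integrable_abs_mul_weight hq hb).const_mul C) ?_
  filter_upwards [hg] with x hx
  rw [norm_mul, Real.norm_eq_abs, Real.norm_eq_abs]
  nlinarith [abs_nonneg (v x)]

theorem mul_weightedMass_le (hp : 1 < p) (hq : (n : ℝ) < 2 * q) (hb : 0 < b)
    (hv : MemLp (fun x => |v x| ^ p) 2 volume) {L c : ℝ} (hL : 0 < L) (hc : 0 ≤ c) :
    c * weightedMass q b v ≤ L * weightedPower p q b v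
      + L ^ (-(1 / (p - 1))) * c ^ (p / (p - 1)) * ∫ x : E n, weight q (b ^ 2) x :=
  mul_integral_le_rpow_add hp hL hc (fun x => (weight_pos (sq_nonneg b) x).le)
    (integrable_weight_sq hq hb) (integrable_abs_mul_weight hq hb)
    (integrable_rpow_mul_weight hq hb hv)

/-- Young's inequality for the nonnegative difference of the weights at two scales. In the remainder
the smaller weight is dropped. This is the part on which the large constant is used in the critical
case. -/
theorem mul_weightedMass_sub_le (hp : 1 < p) (hq : (n : ℝ) < 2 * q) (hb : 0 < b) (hbb : b ≤ b₀)
    (hv : MemLp (fun x => |v x| ^ p) 2 volume) {L c : ℝ} (hL : 0 < L) (hc : 0 ≤ c) :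
    c * (weightedMass q b v - weightedMass q b₀ v)
      ≤ L * (weightedPower p q b v - weightedPower p q b₀ v)
      + L ^ (-(1 / (p - 1))) * c ^ (p / (p - 1)) * ∫ x : E n, weight q (b ^ 2) x := by
  have hq0 := nonneg_of_natCast_lt hq
  have hb₀ : 0 < b₀ := hb.trans_le hbb
  have i1 := integrable_abs_mul_weight (v := v) hq hb
  have i2 := integrable_abs_mul_weight (v := v) hq hb₀
  have j1 := integrable_rpow_mul_weight hq hb hv
  have j2 := integrable_rpow_mul_weight hq hb₀ hv
  have k1 := integrable_weight_sq (n := n) hq hb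
  have k2 := integrable_weight_sq (n := n) hq hb₀
  have h := mul_integral_le_rpow_add (v := v)
    (w := fun x => weight q (b ^ 2) x - weight q (b₀ ^ 2) x) hp hL hc
    (fun x => sub_nonneg.2 (weight_anti hq0 (sq_nonneg b) (by gcongr) x)) (k1.sub k2)
    ((i1.sub i2).congr (Eventually.of_forall fun x => by simp only [Pi.sub_apply]; ring))
    ((j1.sub j2).congr (Eventually.of_forall fun x => by simp only [Pi.sub_apply]; ring))
  simp only [mul_sub (|v _|), mul_sub (|v _| ^ p)] at h
  rw [integral_sub i1 i2, integral_sub j1 j2, integral_sub k1 k2] at h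
  refine h.trans ?_
  have : 0 ≤ ∫ x : E n, weight q (b₀ ^ 2) x :=
    integral_nonneg fun x => (weight_pos (sq_nonneg b₀) x).le
  unfold weightedPower
  gcongr
  linarith

theorem weightedPower_anti (hq : (n : ℝ) < 2 * q) (hb : 0 < b) (hbb : b ≤ b₀)
    (hv : MemLp (fun x => |v x| ^ p) 2 volume) :
    weightedPower p q b₀ v ≤ weightedPower p q b v := by
  refine integral_mono (integrable_rpow_mul_weight hq (hb.trans_le hbb) hv)
    (integrable_rpow_mul_weight hq hb hv) fun x => ?_
  have := weight_anti (nonneg_of_natCast_lt hq) (sq_nonneg b)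
    (show b ^ 2 ≤ b₀ ^ 2 by gcongr) x
  dsimp only
  gcongr

end weighted

/-! ### The weak formulation tested with product functions. -/

section solution

variable {σ μ p : ℝ} {u₀ u₁ : E n → ℝ} {u ut : ℝ → L2 n}

/-- For these times `weightedPower` is the integral of an integrable function rather than a default
value, so the pointwise Young inequality may be integrated in `x`. -/
theorem IsGlobalWeakSolutionWith.ae_memLp (h : IsGlobalWeakSolutionWith σ μ p u₀ u₁ u ut)
    (hp : 1 < p) :
    ∀ᵐ t ∂volume.restrict (Ioi (0 : ℝ)), MemLp (fun x => |ut t x| ^ p) 2 volume := by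
  have hp0 : 0 < p := by linarith
  filter_upwards [ae_eLpNorm_lt_top hp0 h.locallyIntegrableOn_ut h.locally_Lp_ut] with t ht
  exact memLp_abs_rpow hp0 ht

variable {q b T : ℝ} {k : ℕ}

theorem integral_val_eq (hk : k ≠ 0) (hT : 0 < T) (hq : (n : ℝ) < 2 * q) (hb : 0 < b) (t : ℝ) :
    ∫ x, |ut t x| ^ p * (cutoffWeight hk hT hq hb).val t x
      = cutoff k T t * weightedPower p q b (ut t) := by
  rw [weightedPower, ← integral_const_mul]
  refine integral_congr_ae ((cutoffWeight_val hk hT hq hb t).mono fun x hx => ?_)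
  simp only [hx]
  ring

theorem integral_dt_eq (hk : k ≠ 0) (hT : 0 < T) (hq : (n : ℝ) < 2 * q) (hb : 0 < b) (t : ℝ) :
    ∫ x, ut t x * (cutoffWeight hk hT hq hb).dt t x
      = deriv (cutoff k T) t * ∫ x, ut t x * weight q (b ^ 2) x := by
  rw [← integral_const_mul]
  refine integral_congr_ae ((cutoffWeight_dt hk hT hq hb t).mono fun x hx => ?_)
  simp only [hx]
  ring

theorem integral_laplacian_eq (hk : k ≠ 0) (hT : 0 < T) (hq : (n : ℝ) < 2 * q) (hb : 0 < b)
    (t : ℝ) :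
    ∫ x, u t x * (cutoffWeight hk hT hq hb).laplacian t x
      = cutoff k T t * ∫ x, u t x * weightLaplacian q (b ^ 2) x := by
  rw [← integral_const_mul]
  refine integral_congr_ae ((cutoffWeight_laplacian hk hT hq hb t).mono fun x hx => ?_)
  simp only [hx]
  ring

theorem IsGlobalWeakSolutionWith.integrableOn_cutoff_mul
    (h : IsGlobalWeakSolutionWith σ μ p u₀ u₁ u ut) (hk : k ≠ 0) (hT : 0 < T)
    (hq : (n : ℝ) < 2 * q) (hb : 0 < b) :
    IntegrableOn (fun t => cutoff k T t * weightedPower p q b (ut t)) (Ioi 0) := by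
  simpa only [integral_val_eq] using (h.integrable (cutoffWeight hk hT hq hb)).1

theorem integrableOn_cutoff (hk : k ≠ 0) (hT : 0 < T) : IntegrableOn (cutoff k T) (Ioi 0) := by
  have h1 : IntegrableOn (cutoff k T) (Ioc 0 (2 * T)) :=
    (contDiff_cutoff.continuous.continuousOn.integrableOn_compact isCompact_Icc).mono_set
      Ioc_subset_Icc_self
  refine h1.of_forall_sdiff_eq_zero measurableSet_Ioi fun t ht => ?_
  simp only [Set.mem_sdiff, mem_Ioi, mem_Ioc, not_and, not_le] at ht
  exact cutoff_eq_zero hk hT (ht.2 ht.1).le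

theorem IsGlobalWeakSolutionWith.integrableOn_weightedPower
    (h : IsGlobalWeakSolutionWith σ μ p u₀ u₁ u ut) (hT : 0 < T)
    (hq : (n : ℝ) < 2 * q) (hb : 0 < b) :
    IntegrableOn (fun t => weightedPower p q b (ut t)) (Ioc 0 T) := by
  refine ((h.integrableOn_cutoff_mul one_ne_zero hT hq hb).mono_set
    Ioc_subset_Ioi_self).congr_fun (fun t ht => ?_) measurableSet_Ioc
  dsimp only
  rw [cutoff_eq_one hT ht.2, one_mul]

theorem innerSL_toLp_apply {g : E n → ℝ} (hg : MemLp g 2 volume) (v : L2 n) :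
    innerSL ℝ (hg.toLp g) v = ∫ x, v x * g x := by
  rw [innerSL_apply_apply, L2.inner_def]
  refine integral_congr_ae (hg.coeFn_toLp.mono fun x hx => ?_)
  simp only [hx, RCLike.inner_apply, conj_trivial]

/-- Pairing with a fixed function of `x` turns the weak time derivative into a scalar one. -/
theorem HasWeakTimeDeriv.integral_mul (h : HasWeakTimeDeriv u ut)
    (hu : LocallyIntegrableOn u (Ioi 0)) (hut : LocallyIntegrableOn ut (Ioi 0)) {g : E n → ℝ}
    (hg : MemLp g 2) {χ : ℝ → ℝ} (hχ : ContDiff ℝ ∞ χ) (hc : HasCompactSupport χ)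
    (hs : tsupport χ ⊆ Ioi 0) :
    ∫ t in Ioi (0 : ℝ), deriv χ t * ∫ x, u t x * g x
      = -∫ t in Ioi (0 : ℝ), χ t * ∫ x, ut t x * g x := by
  have hint : ∀ (f : ℝ → ℝ) (w : ℝ → L2 n), Continuous f → tsupport f ⊆ tsupport χ →
      LocallyIntegrableOn w (Ioi 0) → IntegrableOn (fun t => f t • w t) (Ioi 0) := by
    intro f w hf hsub hw
    have h1 : IntegrableOn (fun t => f t • w t) (tsupport χ) :=
      (hw.integrableOn_compact_subset hs hc).continuousOn_smul hf.continuousOn hc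
    refine ((integrableOn_iff_integrable_of_support_subset fun t ht => ?_).1 h1).integrableOn
    by_contra hn
    exact ht (by simp only; rw [image_eq_zero_of_notMem_tsupport fun h' => hn (hsub h'), zero_smul])
  have e := congrArg (innerSL ℝ (hg.toLp g)) (h χ hχ hc hs)
  rw [map_neg, ← ContinuousLinearMap.integral_comp_comm _ (hint (deriv χ) u
      (hχ.continuous_deriv (by simp)) (tsupport_deriv_subset) hu),
    ← ContinuousLinearMap.integral_comp_comm _ (hint χ ut hχ.continuous subset_rfl hut)] at e
  simpa only [map_smul, smul_eq_mul, innerSL_toLp_apply] using e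

theorem aestronglyMeasurable_integral_mul (hut : LocallyIntegrableOn ut (Ioi 0)) {g : E n → ℝ}
    (hg : MemLp g 2) :
    AEStronglyMeasurable (fun t => ∫ x, ut t x * g x) (volume.restrict (Ioi (0 : ℝ))) := by
  have := (innerSL ℝ (hg.toLp g)).continuous.comp_aestronglyMeasurable hut.aestronglyMeasurable
  simpa only [innerSL_toLp_apply] using this

end solution

/-! ### Derivation of the weak inequality. -/

section weakInequality

variable {n : ℕ} {σ μ p q : ℝ} {u₀ u₁ : E n → ℝ} {u ut : ℝ → L2 n} {k : ℕ}

/-- The inequality obtained by testing the equation with `cutoff k (R^m)` in time and the weight at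
scale `R` in space, for all `R ≥ 1`. -/
def WeakInequality (p q m K : ℝ) (k : ℕ) (u₁ : E n → ℝ) (ut : ℝ → L2 n) : Prop :=
  ∀ R : ℝ, 1 ≤ R → ∃ J : ℝ → ℝ, IntegrableOn J (Ioc 0 (2 * R ^ m)) ∧
    (∀ t, 0 < t → |J t| ≤ K * R ^ (-m) * cutoff k (R ^ m) t ^ (1 / p) * weightedMass q R⁻¹ (ut t)) ∧
    (∫ t in Ioi (0 : ℝ), cutoff k (R ^ m) t * weightedPower p q R⁻¹ (ut t))
        + ∫ x, u₁ x * weight q (R⁻¹ ^ 2) x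
      ≤ (∫ t in Ioc (0 : ℝ) (2 * R ^ m), J t) + K * R ^ (-m)

theorem locallyIntegrableOn_integral_mul (hu : LocallyIntegrableOn u (Ioi 0)) {g : E n → ℝ}
    (hg : MemLp g 2 volume) : LocallyIntegrableOn (fun t => ∫ x, u t x * g x) (Ioi 0) := by
  intro t ht
  obtain ⟨s, hs, hi⟩ := hu t ht
  refine ⟨s, hs, ?_⟩
  have h := (innerSL ℝ (hg.toLp g)).integrable_comp hi
  simp only [innerSL_toLp_apply] at h
  exact h

/-- Gives the damping and Laplacian terms the same factor `η^(1/p)` that the derivative of the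
cutoff carries. -/
theorem cutoff_le_rpow (hp : 1 < p) (T t : ℝ) : cutoff k T t ≤ cutoff k T t ^ (1 / p) :=
  Real.self_le_rpow_of_le_one (cutoff_nonneg t) (cutoff_le_one t)
    ((div_le_one (by linarith)).2 hp.le)

/-- Integration by parts in time of the term `∫∫ u Δφ`. -/
theorem IsGlobalWeakSolutionWith.integral_laplacian
    (h : IsGlobalWeakSolutionWith σ μ p u₀ u₁ u ut) (hp : 1 < p) (hk : k ≠ 0) {T b : ℝ}
    (hT : 0 < T) (hq : (n : ℝ) < 2 * q) (hb : 0 < b) :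
    IntegrableOn (fun t => cutoffTail k T t * ∫ x, ut t x * weightLaplacian q (b ^ 2) x) (Ioi 0) ∧
    ∫ t in Ioi (0 : ℝ), cutoff k T t * ∫ x, u t x * weightLaplacian q (b ^ 2) x
      = cutoffTail k T 0 * (∫ x, u₀ x * weightLaplacian q (b ^ 2) x)
        + ∫ t in Ioi (0 : ℝ), cutoffTail k T t * ∫ x, ut t x * weightLaplacian q (b ^ 2) x := by
  have hq0 := nonneg_of_natCast_lt hq
  have hL := memLp_weightLaplacian hq hb
  set C : ℝ := n * (2 * q * (2 * (q + 1) + 1)) with hC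
  have hC0 : 0 ≤ C := by positivity
  set I : ℝ := ∫ x : E n, weight q (b ^ 2) x with hI
  have hint : IntegrableOn
      (fun t => cutoffTail k T t * ∫ x, ut t x * weightLaplacian q (b ^ 2) x) (Ioi 0) := by
    -- A majorant from Young's inequality with both parameters equal to `1`; only integrability in
    -- time matters here, and it is inherited from that of `∫ |u_t|^p φ`.
    have hdom : IntegrableOn (fun t => 2 * T * (C * b ^ 2) *
        (cutoff k T t * weightedPower p q b (ut t) + cutoff k T t * I)) (Ioi 0) :=
      ((h.integrableOn_cutoff_mul hk hT hq hb).add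
        ((integrableOn_cutoff hk hT).mul_const I)).const_mul _
    refine hdom.mono' (contDiff_cutoffTail.continuous.aestronglyMeasurable.mul
      (aestronglyMeasurable_integral_mul h.locallyIntegrableOn_ut hL)) ?_
    filter_upwards [h.ae_memLp hp, ae_restrict_mem measurableSet_Ioi] with t ht ht0
    have h1 := cutoffTail_le hk hT (le_of_lt ht0)
    have h0 := cutoffTail_nonneg hk hT t
    have h2 : |∫ x, ut t x * weightLaplacian q (b ^ 2) x|
        ≤ C * b ^ 2 * weightedMass q b (ut t) :=
      abs_integral_mul_le hq hb
        (Eventually.of_forall fun x => abs_weightLaplacian_le hq0 (sq_nonneg b) x)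
    have h3 := mul_weightedMass_le hp hq hb ht one_pos zero_le_one
    simp only [Real.one_rpow, one_mul] at h3
    have hm := weightedMass_nonneg (q := q) (b := b) (v := ut t)
    have hc := cutoff_nonneg (k := k) (T := T) t
    rw [norm_mul, Real.norm_of_nonneg h0, Real.norm_eq_abs]
    calc _ ≤ (2 * T * cutoff k T t) * (C * b ^ 2 * weightedMass q b (ut t)) := by gcongr
      _ ≤ (2 * T * cutoff k T t) * (C * b ^ 2 * (weightedPower p q b (ut t) + I)) := by gcongr
      _ = _ := by ring
  refine ⟨hint, ?_⟩
  refine integral_mul_eq_of_weak_deriv contDiff_cutoffTail hasDerivAt_cutoffTail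
    (fun t ht => cutoffTail_eq_zero hk hT ht)
    (fun χ h1 h2 h3 => h.hasWeakTimeDeriv.integral_mul h.locallyIntegrableOn
      h.locallyIntegrableOn_ut hL h1 h2 h3)
    (locallyIntegrableOn_integral_mul h.locallyIntegrableOn hL) ?_ hint ?_
  · simpa only [integral_laplacian_eq] using (h.integrable (cutoffWeight hk hT hq hb)).2.2.1
  · have e : ∀ v : E n → ℝ, ∫ x, v x * hL.toLp _ x = ∫ x, v x * weightLaplacian q (b ^ 2) x :=
      fun v => integral_congr_ae (hL.coeFn_toLp.mono fun x hx => by simp only [hx])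
    simpa only [e] using h.initial (hL.toLp _)

/-- All terms containing `u_t` linearly are collected in one function `J` of time; the boundary term
from `u₀` is the additive error `K R^(-m)`. -/
theorem IsGlobalWeakSolutionWith.exists_weakInequality
    (h : IsGlobalWeakSolutionWith σ μ p u₀ u₁ u ut) (hn : 1 ≤ n) (hσ : 0 < σ) (hσ2 : σ ≤ 2)
    (hμ : 0 < μ) (hp : 1 < p) (hk : p / (p - 1) ≤ k) (hu₀ : Integrable u₀) :
    ∃ K : ℝ, 0 ≤ K ∧ WeakInequality p ((n : ℝ) / 2 + σ / 2) (min σ 1) K k u₁ ut := by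
  have hq : (n : ℝ) < 2 * ((n : ℝ) / 2 + σ / 2) := by linarith
  have hq0 := nonneg_of_natCast_lt hq
  have hk0 : k ≠ 0 := by
    rintro rfl
    have : 0 < p / (p - 1) := div_pos (by linarith) (by linarith)
    norm_num at hk
    linarith
  obtain ⟨Cη, hCη, hη⟩ := exists_abs_deriv_cutoff_le hp hk
  obtain ⟨Cd, hCd, hd⟩ := exists_abs_damping_cutoffWeight_le hn hσ hσ2 hq hk0
  set q : ℝ := (n : ℝ) / 2 + σ / 2
  set m : ℝ := min σ 1
  set CL : ℝ := n * (2 * q * (2 * (q + 1) + 1))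
  have hCL : 0 ≤ CL := by positivity
  set I₀ : ℝ := ∫ x, |u₀ x|
  have hI₀ : 0 ≤ I₀ := integral_nonneg fun x => abs_nonneg _
  refine ⟨Cη + 2 * CL + μ * Cd + 2 * CL * I₀, by positivity, fun R hR => ?_⟩
  have hR0 : 0 < R := by linarith
  have hT : 0 < R ^ m := Real.rpow_pos_of_pos hR0 m
  have hb : 0 < R⁻¹ := by positivity
  have hLap : ∀ x : E n, |weightLaplacian q (R⁻¹ ^ 2) x| ≤ CL * R⁻¹ ^ 2 * weight q (R⁻¹ ^ 2) x :=
    fun x => abs_weightLaplacian_le hq0 (sq_nonneg _) x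
  -- This is where `m ≤ 1` enters: `m - 2 ≤ -m`. The bound `m ≤ σ` enters next, for the damping.
  have hTb : R ^ m * R⁻¹ ^ 2 ≤ R ^ (-m) := by
    rw [inv_pow, ← Real.rpow_natCast, ← Real.rpow_neg hR0.le, ← Real.rpow_add hR0]
    refine Real.rpow_le_rpow_of_exponent_le hR ?_
    have : m ≤ 1 := min_le_right _ _
    push_cast
    linarith
  have hbσ : R⁻¹ ^ σ ≤ R ^ (-m) := by
    rw [Real.inv_rpow hR0.le, ← Real.rpow_neg hR0.le]
    exact Real.rpow_le_rpow_of_exponent_le hR (neg_le_neg (min_le_left _ _))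
  have hRm : 0 < R ^ (-m) := Real.rpow_pos_of_pos hR0 _
  have hTinv : (R ^ m)⁻¹ = R ^ (-m) := (Real.rpow_neg hR0.le m).symm
  set Φ := cutoffWeight hk0 hT hq hb with hΦ
  obtain ⟨iΘ, eΘ⟩ := h.integral_laplacian hp hk0 hT hq hb
  obtain ⟨-, i2, -, i4⟩ := h.integrable Φ
  have hw := h.weak Φ
  have e0 : ∫ x, u₁ x * Φ.val 0 x = ∫ x, u₁ x * weight q (R⁻¹ ^ 2) x := by
    refine integral_congr_ae ((cutoffWeight_val hk0 hT hq hb 0).mono fun x hx => ?_)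
    simp only [hΦ, hx, cutoff_eq_one hT hT.le, one_mul]
  rw [e0] at hw
  simp only [hΦ, integral_val_eq, integral_laplacian_eq] at hw
  rw [← hΦ, eΘ] at hw
  set J : ℝ → ℝ := fun t => -(∫ x, ut t x * Φ.dt t x)
    - (cutoffTail k (R ^ m) t * ∫ x, ut t x * weightLaplacian q (R⁻¹ ^ 2) x)
    + μ * ∫ x, ut t x * Φ.damping σ t x with hJ
  have iJ : IntegrableOn J (Ioi 0) := (i2.neg.sub iΘ).add (i4.const_mul μ)
  have eJ : ∫ t in Ioi (0 : ℝ), J t = -(∫ t in Ioi (0 : ℝ), ∫ x, ut t x * Φ.dt t x)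
      - (∫ t in Ioi (0 : ℝ), cutoffTail k (R ^ m) t *
          ∫ x, ut t x * weightLaplacian q (R⁻¹ ^ 2) x)
      + μ * ∫ t in Ioi (0 : ℝ), ∫ x, ut t x * Φ.damping σ t x := by
    have a1 : IntegrableOn (fun t => -(∫ x, ut t x * Φ.dt t x)
      - (cutoffTail k (R ^ m) t * ∫ x, ut t x * weightLaplacian q (R⁻¹ ^ 2) x)) (Ioi 0) :=
      i2.neg.sub iΘ
    have a2 : IntegrableOn (fun t => -(∫ x, ut t x * Φ.dt t x)) (Ioi 0) := i2.neg
    rw [hJ, integral_add a1 (i4.const_mul μ), integral_sub a2 iΘ, integral_neg,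
      integral_const_mul]
  have bJ : ∀ t, 0 < t → |J t| ≤ (Cη + 2 * CL + μ * Cd) * R ^ (-m)
      * cutoff k (R ^ m) t ^ (1 / p) * weightedMass q R⁻¹ (ut t) := by
    intro t ht
    set B := weightedMass q R⁻¹ (ut t)
    have hB : 0 ≤ B := weightedMass_nonneg
    have hc := cutoff_nonneg (k := k) (T := R ^ m) t
    have hcp := cutoff_le_rpow (k := k) hp (R ^ m) t
    have hcp0 := hc.trans hcp
    have b1 : |∫ x, ut t x * Φ.dt t x| ≤ Cη * R ^ (-m) * cutoff k (R ^ m) t ^ (1 / p) * B := by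
      rw [hΦ, integral_dt_eq, abs_mul]
      have := abs_integral_mul_le (v := ut t) (C := 1) hq hb
        (Eventually.of_forall fun x => by
          rw [abs_of_pos (weight_pos (sq_nonneg R⁻¹) x), one_mul])
      rw [one_mul] at this
      have h2 := hη (R ^ m) hT t
      rw [div_eq_mul_inv, hTinv] at h2
      gcongr
    have b2 : |cutoffTail k (R ^ m) t * ∫ x, ut t x * weightLaplacian q (R⁻¹ ^ 2) x|
        ≤ 2 * CL * R ^ (-m) * cutoff k (R ^ m) t ^ (1 / p) * B := by
      rw [abs_mul, abs_of_nonneg (cutoffTail_nonneg hk0 hT t)]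
      have h1 := abs_integral_mul_le (v := ut t) hq hb (Eventually.of_forall hLap)
      have h2 := cutoffTail_le hk0 hT ht.le
      calc _ ≤ (2 * R ^ m * cutoff k (R ^ m) t) * (CL * R⁻¹ ^ 2 * B) :=
            mul_le_mul h2 h1 (abs_nonneg _) (by positivity)
        _ = 2 * CL * (R ^ m * R⁻¹ ^ 2) * cutoff k (R ^ m) t * B := by ring
        _ ≤ _ := by gcongr
    have b3 : |∫ x, ut t x * Φ.damping σ t x|
        ≤ Cd * R ^ (-m) * cutoff k (R ^ m) t ^ (1 / p) * B := by
      refine (abs_integral_mul_le hq hb (hd (R ^ m) R⁻¹ hT hb t)).trans ?_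
      gcongr
    calc |J t| ≤ |∫ x, ut t x * Φ.dt t x|
          + |cutoffTail k (R ^ m) t * ∫ x, ut t x * weightLaplacian q (R⁻¹ ^ 2) x|
          + μ * |∫ x, ut t x * Φ.damping σ t x| := by
          refine (abs_add_le _ _).trans ?_
          rw [abs_mul, abs_of_pos hμ]
          gcongr
          refine (abs_sub _ _).trans ?_
          rw [abs_neg]
      _ ≤ Cη * R ^ (-m) * cutoff k (R ^ m) t ^ (1 / p) * B
          + 2 * CL * R ^ (-m) * cutoff k (R ^ m) t ^ (1 / p) * B
          + μ * (Cd * R ^ (-m) * cutoff k (R ^ m) t ^ (1 / p) * B) := by gcongr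
      _ = _ := by ring
  refine ⟨J, iJ.mono_set Ioc_subset_Ioi_self, fun t ht => (bJ t ht).trans ?_, ?_⟩
  · exact mul_le_mul_of_nonneg_right (mul_le_mul_of_nonneg_right (mul_le_mul_of_nonneg_right
      (le_add_of_nonneg_right (by positivity)) hRm.le) (Real.rpow_nonneg (cutoff_nonneg t) _))
      weightedMass_nonneg
  · have e1 : ∫ t in Ioc (0 : ℝ) (2 * R ^ m), J t = ∫ t in Ioi (0 : ℝ), J t := by
      refine (setIntegral_eq_of_subset_of_forall_sdiff_eq_zero measurableSet_Ioi
        Ioc_subset_Ioi_self fun t ht => ?_).symm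
      simp only [Set.mem_sdiff, mem_Ioi, mem_Ioc, not_and, not_le] at ht
      have := bJ t ht.1
      rw [cutoff_eq_zero hk0 hT (ht.2 ht.1).le, Real.zero_rpow (by positivity), mul_zero,
        zero_mul] at this
      exact abs_nonpos_iff.1 this
    have hu : |∫ x, u₀ x * weightLaplacian q (R⁻¹ ^ 2) x| ≤ CL * R⁻¹ ^ 2 * I₀ := by
      rw [← Real.norm_eq_abs, ← integral_const_mul]
      refine norm_integral_le_of_norm_le (hu₀.abs.const_mul _) (Eventually.of_forall fun x => ?_)
      rw [norm_mul, Real.norm_eq_abs, Real.norm_eq_abs, mul_comm]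
      have hw1 := weight_le_one (q := q) hq0 (sq_nonneg R⁻¹) x
      have : |weightLaplacian q (R⁻¹ ^ 2) x| ≤ CL * R⁻¹ ^ 2 * 1 := (hLap x).trans (by gcongr)
      rw [mul_one] at this
      gcongr
    have hΘ0 : cutoffTail k (R ^ m) 0 ≤ 2 * R ^ m := by
      have := cutoffTail_le hk0 hT le_rfl
      rwa [cutoff_eq_one hT hT.le, mul_one] at this
    have hbd : |cutoffTail k (R ^ m) 0 * ∫ x, u₀ x * weightLaplacian q (R⁻¹ ^ 2) x|
        ≤ 2 * CL * I₀ * R ^ (-m) := by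
      rw [abs_mul, abs_of_nonneg (cutoffTail_nonneg hk0 hT 0)]
      calc _ ≤ (2 * R ^ m) * (CL * R⁻¹ ^ 2 * I₀) :=
            mul_le_mul hΘ0 hu (abs_nonneg _) (by positivity)
        _ = 2 * CL * I₀ * (R ^ m * R⁻¹ ^ 2) := by ring
        _ ≤ _ := by gcongr
    have hx := (abs_le.1 hbd).1
    have hfin : 0 ≤ (Cη + 2 * CL + μ * Cd) * R ^ (-m) := by positivity
    rw [e1, eJ, hw]
    linarith

end weakInequality

/-! ### Uniform bound, smallness in the critical case, and contradiction. -/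

section nonexistence

variable {n : ℕ} {σ μ p q m K : ℝ} {u₀ u₁ : E n → ℝ} {u ut : ℝ → L2 n} {k : ℕ}

theorem integral_weight_nonneg (R : ℝ) : 0 ≤ ∫ x : E n, weight q (R ^ 2) x :=
  integral_nonneg fun x => (weight_pos (sq_nonneg R) x).le

/-- In the range `n (p - 1) ≤ m` the space-time volume is absorbed by the decay of the
coefficients. -/
theorem rpow_mul_integral_weight_le (hp : 1 < p) (hcrit : n * (p - 1) ≤ m) (hK : 0 ≤ K) {R : ℝ}
    (hR : 1 ≤ R) :
    (K * R ^ (-m)) ^ (p / (p - 1)) * (∫ x : E n, weight q (R⁻¹ ^ 2) x) * (2 * R ^ m)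
      ≤ 2 * K ^ (p / (p - 1)) * ∫ x : E n, weight q 1 x := by
  have hR0 : 0 < R := by linarith
  have hp1 : 0 < p - 1 := by linarith
  have hI : 0 ≤ ∫ x : E n, weight q 1 x := by simpa using integral_weight_nonneg (n := n) (q := q) 1
  rw [integral_weight_sq (by positivity), inv_pow, inv_inv,
    Real.mul_rpow hK (Real.rpow_nonneg hR0.le _), ← Real.rpow_mul hR0.le, ← Real.rpow_natCast R n]
  have h1 : R ^ (-m * (p / (p - 1))) * R ^ (n : ℝ) * R ^ m ≤ 1 := by
    rw [← Real.rpow_add hR0, ← Real.rpow_add hR0]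
    refine Real.rpow_le_one_of_one_le_of_nonpos hR ?_
    have : -m * (p / (p - 1)) + n + m = (n * (p - 1) - m) / (p - 1) := by field_simp; ring
    rw [this]
    exact div_nonpos_of_nonpos_of_nonneg (by linarith) hp1.le
  calc _ = 2 * K ^ (p / (p - 1)) * (∫ x : E n, weight q 1 x)
        * (R ^ (-m * (p / (p - 1))) * R ^ (n : ℝ) * R ^ m) := by ring
    _ ≤ 2 * K ^ (p / (p - 1)) * (∫ x : E n, weight q 1 x) * 1 := by gcongr
    _ = _ := mul_one _

/-- Young's inequality with `L = η/2`: the powers of `η` cancel in the remainder, because `(1/p) ·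
p/(p-1) = 1/(p-1)`. Times with `η = 0` are treated separately. -/
theorem rpow_mul_cutoff_mass_le (hp : 1 < p) (hq : (n : ℝ) < 2 * q) {b c η : ℝ} (hb : 0 < b)
    (hc : 0 ≤ c) (hη : 0 ≤ η) {v : L2 n} (hv : MemLp (fun x => |v x| ^ p) 2 volume) :
    c * η ^ (1 / p) * weightedMass q b v ≤ 1 / 2 * (η * weightedPower p q b v)
      + (1 / 2) ^ (-(1 / (p - 1))) * c ^ (p / (p - 1)) * ∫ x : E n, weight q (b ^ 2) x := by
  have hp0 : 0 < p := by linarith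
  have hp1 : 0 < p - 1 := by linarith
  rcases hη.eq_or_lt with rfl | hη0
  · rw [Real.zero_rpow (by positivity)]
    have := integral_weight_nonneg (n := n) (q := q) b
    simp only [mul_zero, zero_mul, zero_add]
    positivity
  · refine (mul_weightedMass_le hp hq hb hv (L := 1 / 2 * η) (by positivity)
      (by positivity)).trans_eq ?_
    rw [Real.mul_rpow hc (by positivity), ← Real.rpow_mul hη, Real.mul_rpow (by norm_num) hη,
      Real.rpow_neg hη, show 1 / p * (p / (p - 1)) = 1 / (p - 1) by field_simp]
    have : η ^ (1 / (p - 1)) ≠ 0 := (Real.rpow_pos_of_pos hη0 _).ne'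
    field_simp

theorem abs_integral_mul_weight_le (hq : 0 ≤ q) (hu₁ : Integrable u₁) (b : ℝ) :
    |∫ x, u₁ x * weight q (b ^ 2) x| ≤ ∫ x, |u₁ x| := by
  rw [← Real.norm_eq_abs]
  refine norm_integral_le_of_norm_le hu₁.abs (Eventually.of_forall fun x => ?_)
  rw [norm_mul, Real.norm_eq_abs, Real.norm_of_nonneg (weight_pos (sq_nonneg b) x).le]
  exact mul_le_of_le_one_right (abs_nonneg _) (weight_le_one hq (sq_nonneg b) x)

/-- Half of the nonlinear integral is moved to the left, which is legitimate because it is finite;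
the remainder is bounded by the scaling condition `n(p-1) ≤ m`, and the datum by `∫ |u₁|`. -/
theorem IsGlobalWeakSolutionWith.exists_bound_cutoff
    (h : IsGlobalWeakSolutionWith σ μ p u₀ u₁ u ut) (hW : WeakInequality p q m K k u₁ ut)
    (hk : k ≠ 0) (hp : 1 < p) (hq : (n : ℝ) < 2 * q) (hm : 0 < m) (hK : 0 ≤ K)
    (hcrit : n * (p - 1) ≤ m) (hu₁ : Integrable u₁) :
    ∃ M : ℝ, ∀ R : ℝ, 1 ≤ R →
      ∫ t in Ioi (0 : ℝ), cutoff k (R ^ m) t * weightedPower p q R⁻¹ (ut t) ≤ M := by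
  set C : ℝ := (1 / 2) ^ (-(1 / (p - 1)))
  have hC : 0 ≤ C := by positivity
  refine ⟨2 * (C * (2 * K ^ (p / (p - 1)) * ∫ x : E n, weight q 1 x) + K + ∫ x, |u₁ x|),
    fun R hR => ?_⟩
  have hR0 : 0 < R := by linarith
  have hT : 0 < R ^ m := Real.rpow_pos_of_pos hR0 m
  have hRm : 0 < R ^ (-m) := Real.rpow_pos_of_pos hR0 _
  have hb : 0 < R⁻¹ := by positivity
  obtain ⟨J, hJi, hJ, hle⟩ := hW R hR
  have hX := h.integrableOn_cutoff_mul hk hT hq hb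
  set c : ℝ := C * (K * R ^ (-m)) ^ (p / (p - 1)) * ∫ x : E n, weight q (R⁻¹ ^ 2) x with hc
  have hX2 : IntegrableOn (fun t => 1 / 2 * (cutoff k (R ^ m) t * weightedPower p q R⁻¹ (ut t)))
      (Ioc 0 (2 * R ^ m)) := (hX.mono_set Ioc_subset_Ioi_self).const_mul _
  have hci : IntegrableOn (fun _ : ℝ => c) (Ioc 0 (2 * R ^ m)) := integrableOn_const measure_Ioc_lt_top.ne
  have h1 : ∫ t in Ioc (0 : ℝ) (2 * R ^ m), J t ≤ ∫ t in Ioc (0 : ℝ) (2 * R ^ m),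
      (1 / 2 * (cutoff k (R ^ m) t * weightedPower p q R⁻¹ (ut t)) + c) := by
    refine integral_mono_ae hJi (hX2.add hci) ?_
    filter_upwards [ae_restrict_of_ae_restrict_of_subset Ioc_subset_Ioi_self (h.ae_memLp hp),
      ae_restrict_mem measurableSet_Ioc] with t ht ht0
    exact (le_abs_self _).trans ((hJ t ht0.1).trans
      (rpow_mul_cutoff_mass_le hp hq hb (by positivity) (cutoff_nonneg t) ht))
  have h2 : ∫ t in Ioc (0 : ℝ) (2 * R ^ m), cutoff k (R ^ m) t * weightedPower p q R⁻¹ (ut t)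
      ≤ ∫ t in Ioi (0 : ℝ), cutoff k (R ^ m) t * weightedPower p q R⁻¹ (ut t) :=
    setIntegral_mono_set hX
      (Eventually.of_forall fun t => mul_nonneg (cutoff_nonneg t) weightedPower_nonneg)
      Ioc_subset_Ioi_self.eventuallyLE
  have h3 : 2 * R ^ m * c ≤ C * (2 * K ^ (p / (p - 1)) * ∫ x : E n, weight q 1 x) := by
    have := rpow_mul_integral_weight_le (q := q) hp hcrit hK hR
    calc _ = C * ((K * R ^ (-m)) ^ (p / (p - 1)) * (∫ x : E n, weight q (R⁻¹ ^ 2) x)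
          * (2 * R ^ m)) := by rw [hc]; ring
      _ ≤ _ := by gcongr
  rw [integral_add hX2 hci, integral_const_mul, setIntegral_const, smul_eq_mul, measureReal_def,
    Real.volume_Ioc, sub_zero, ENNReal.toReal_ofReal (by positivity)] at h1
  have h4 := (abs_le.1 (abs_integral_mul_weight_le (nonneg_of_natCast_lt hq) hu₁ R⁻¹)).1
  have h5 : K * R ^ (-m) ≤ K :=
    mul_le_of_le_one_right hK (Real.rpow_le_one_of_one_le_of_nonpos hR (by linarith))
  linarith

theorem IsGlobalWeakSolutionWith.exists_bound_integral_weightedPower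
    (h : IsGlobalWeakSolutionWith σ μ p u₀ u₁ u ut) (hW : WeakInequality p q m K k u₁ ut)
    (hk : k ≠ 0) (hp : 1 < p) (hq : (n : ℝ) < 2 * q) (hm : 0 < m) (hK : 0 ≤ K)
    (hcrit : n * (p - 1) ≤ m) (hu₁ : Integrable u₁) :
    ∃ M : ℝ, ∀ R : ℝ, 1 ≤ R →
      ∫ t in Ioc (0 : ℝ) (2 * R ^ m), weightedPower p q R⁻¹ (ut t) ≤ M := by
  obtain ⟨M, hM⟩ := h.exists_bound_cutoff hW hk hp hq hm hK hcrit hu₁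
  refine ⟨M, fun R hR => ?_⟩
  have hR0 : 0 < R := by linarith
  -- Chosen so that `R'^m = 2R^m`: the cutoff at scale `R'` equals one on the whole support in time
  -- of the cutoff at scale `R`, and the weight only grows with the scale.
  set R' : ℝ := 2 ^ (1 / m) * R with hR'
  have h2 : (1 : ℝ) ≤ 2 ^ (1 / m) := Real.one_le_rpow (by norm_num) (by positivity)
  have hRR : R ≤ R' := by rw [hR']; nlinarith
  have hR0' : 0 < R' := by linarith
  have hTT : R' ^ m = 2 * R ^ m := by
    rw [hR', Real.mul_rpow (by positivity) hR0.le, ← Real.rpow_mul (by norm_num),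
      one_div_mul_cancel hm.ne', Real.rpow_one]
  have hT' : 0 < R' ^ m := Real.rpow_pos_of_pos hR0' m
  have i1 : IntegrableOn (fun t => weightedPower p q R⁻¹ (ut t)) (Ioc 0 (2 * R ^ m)) :=
    h.integrableOn_weightedPower (hTT ▸ hT') hq (inv_pos.2 hR0)
  have i2 := h.integrableOn_cutoff_mul (k := k) hk hT' hq (inv_pos.2 hR0')
  refine (le_trans (integral_mono_ae i1 (i2.mono_set Ioc_subset_Ioi_self) ?_)
    (setIntegral_mono_set i2
      (Eventually.of_forall fun t => mul_nonneg (cutoff_nonneg t) weightedPower_nonneg)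
      Ioc_subset_Ioi_self.eventuallyLE)).trans (hM R' (by linarith))
  filter_upwards [ae_restrict_of_ae_restrict_of_subset Ioc_subset_Ioi_self (h.ae_memLp hp),
    ae_restrict_mem measurableSet_Ioc] with t ht ht0
  rw [cutoff_eq_one hT' (hTT ▸ ht0.2), one_mul]
  exact weightedPower_anti hq (inv_pos.2 hR0') (by gcongr) ht

/-- `R₀` is a point where `Y` is within `δ` of its supremum; neither monotonicity nor a limit is
required. -/
theorem exists_forall_sub_le_of_bounded {Y : ℝ → ℝ} {M : ℝ}
    (hM : ∀ R, 1 ≤ R → Y R ≤ M) {δ : ℝ}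
    (hδ : 0 < δ) : ∃ R₀, 1 ≤ R₀ ∧ ∀ R, R₀ ≤ R → Y R - Y R₀ ≤ δ := by
  set S := Y '' Ici 1
  have hbdd : BddAbove S := ⟨M, by rintro _ ⟨R, hR, rfl⟩; exact hM R hR⟩
  obtain ⟨_, ⟨R₀, hR₀, rfl⟩, hlt⟩ := exists_lt_of_lt_csSup
    (⟨Y 1, 1, self_mem_Ici, rfl⟩ : S.Nonempty) (show sSup S - δ < sSup S by linarith)
  refine ⟨R₀, hR₀, fun R hR => ?_⟩
  have : Y R ≤ sSup S := le_csSup hbdd ⟨R, le_trans hR₀ hR, rfl⟩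
  linarith

theorem tendsto_integral_mul_weight (hq : 0 ≤ q) (hu₁ : Integrable u₁) :
    Tendsto (fun R : ℝ => ∫ x, u₁ x * weight q (R⁻¹ ^ 2) x) atTop (𝓝 (∫ x, u₁ x)) := by
  refine tendsto_integral_filter_of_dominated_convergence (fun x => ‖u₁ x‖) ?_ ?_ hu₁.norm ?_
  · exact Eventually.of_forall fun R =>
      hu₁.aestronglyMeasurable.mul (continuous_weight (sq_nonneg _)).aestronglyMeasurable
  · refine Eventually.of_forall fun R => Eventually.of_forall fun x => ?_
    rw [norm_mul, Real.norm_of_nonneg (weight_pos (sq_nonneg _) x).le]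
    exact mul_le_of_le_one_right (norm_nonneg _) (weight_le_one hq (sq_nonneg _) x)
  · refine Eventually.of_forall fun x => ?_
    have h0 : Tendsto (fun R : ℝ => 1 + R⁻¹ ^ 2 * ‖x‖ ^ 2) atTop (𝓝 (1 + 0 ^ 2 * ‖x‖ ^ 2)) :=
      ((tendsto_inv_atTop_zero.pow 2).mul_const _).const_add 1
    have h1 := h0.rpow_const (p := -q) (Or.inl (by norm_num))
    have h2 := h1.const_mul (u₁ x)
    rw [show u₁ x * ((1 : ℝ) + 0 ^ 2 * ‖x‖ ^ 2) ^ (-q) = u₁ x by simp] at h2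
    exact h2

/-- The right-hand side of the weak inequality becomes small as `R → ∞`. -/
theorem IsGlobalWeakSolutionWith.eventually_integral_le
    (h : IsGlobalWeakSolutionWith σ μ p u₀ u₁ u ut) (hp : 1 < p) (hq : (n : ℝ) < 2 * q)
    (hm : 0 < m) (hK : 0 ≤ K) (hcrit : n * (p - 1) ≤ m) {M : ℝ}
    (hM : ∀ R : ℝ, 1 ≤ R → ∫ t in Ioc (0 : ℝ) (2 * R ^ m), weightedPower p q R⁻¹ (ut t) ≤ M)
    {δ : ℝ} (hδ : 0 < δ) :
    ∀ᶠ R : ℝ in atTop, ∀ J : ℝ → ℝ, IntegrableOn J (Ioc 0 (2 * R ^ m)) →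
      (∀ t, 0 < t → J t ≤ K * R ^ (-m) * weightedMass q R⁻¹ (ut t)) →
      ∫ t in Ioc (0 : ℝ) (2 * R ^ m), J t ≤ δ := by
  have hp1 : 0 < p - 1 := by linarith
  have hp' : 0 < p / (p - 1) := by positivity
  set Y : ℝ → ℝ := fun R => ∫ t in Ioc (0 : ℝ) (2 * R ^ m), weightedPower p q R⁻¹ (ut t) with hY
  set D : ℝ := 2 * K ^ (p / (p - 1)) * ∫ x : E n, weight q 1 x
  -- The order of choices matters: `L` makes the critical remainder small, `R₀` then makes the
  -- increment of `Y` small relative to `1/L`, `ε` controls the part at scale `R₀`, and `R` comes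
  -- last. Each contributes at most `δ/4`.
  obtain ⟨L, hL0, hL⟩ : ∃ L : ℝ, 0 < L ∧ L ^ (-(1 / (p - 1))) * D ≤ δ / 4 := by
    have ht : Tendsto (fun L : ℝ => L ^ (-(1 / (p - 1))) * D) atTop (𝓝 (0 * D)) :=
      (tendsto_rpow_neg_atTop (by positivity)).mul_const D
    rw [zero_mul] at ht
    obtain ⟨L, h1, h2⟩ := ((eventually_gt_atTop (0 : ℝ)).and
      (ht.eventually_le_const (show 0 < δ / 4 by positivity))).exists
    exact ⟨L, h1, h2⟩
  obtain ⟨R₀, hR₀, hYR₀⟩ := exists_forall_sub_le_of_bounded (Y := Y) (M := M) hM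
    (show 0 < δ / (4 * L) by positivity)
  have hR₀0 : 0 < R₀ := by linarith
  have hT₀ : 0 < R₀ ^ m := Real.rpow_pos_of_pos hR₀0 m
  have hM0 : 0 ≤ M := (integral_nonneg fun t => weightedPower_nonneg).trans (hM 1 le_rfl)
  set ε : ℝ := δ / (4 * (M + 1))
  have hε : 0 < ε := by positivity
  have hεM : ε * Y R₀ ≤ δ / 4 := by
    calc ε * Y R₀ ≤ ε * (M + 1) := by gcongr; linarith [hM R₀ hR₀]
      _ = δ / 4 := by simp only [ε]; field_simp
  have hsmall : Tendsto (fun R : ℝ => ε ^ (-(1 / (p - 1))) * (K * R ^ (-m)) ^ (p / (p - 1))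
      * (∫ x : E n, weight q (R₀⁻¹ ^ 2) x) * (2 * R₀ ^ m)) atTop (𝓝 0) := by
    have h1 : Tendsto (fun R : ℝ => K * R ^ (-m)) atTop (𝓝 0) := by
      simpa using (tendsto_rpow_neg_atTop hm).const_mul K
    have h2 := h1.rpow_const (p := p / (p - 1)) (Or.inr hp'.le)
    rw [Real.zero_rpow hp'.ne'] at h2
    have h3 := ((h2.const_mul (ε ^ (-(1 / (p - 1))))).mul_const
      (∫ x : E n, weight q (R₀⁻¹ ^ 2) x)).mul_const (2 * R₀ ^ m)
    rwa [mul_zero, zero_mul, zero_mul] at h3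
  filter_upwards [eventually_ge_atTop R₀,
    hsmall.eventually_le_const (show 0 < δ / 4 by positivity)] with R hRR hRs J hJi hJ
  have hR : 1 ≤ R := hR₀.trans hRR
  have hR0 : 0 < R := by linarith
  have hT : 0 < R ^ m := Real.rpow_pos_of_pos hR0 m
  have hc0 : 0 ≤ K * R ^ (-m) := mul_nonneg hK (Real.rpow_pos_of_pos hR0 _).le
  have hb : 0 < R⁻¹ := inv_pos.2 hR0
  have hb₀ : 0 < R₀⁻¹ := inv_pos.2 hR₀0
  have hsub : Ioc (0 : ℝ) (2 * R₀ ^ m) ⊆ Ioc 0 (2 * R ^ m) := Ioc_subset_Ioc_right (by gcongr)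
  set c₁ : ℝ := L ^ (-(1 / (p - 1))) * (K * R ^ (-m)) ^ (p / (p - 1))
    * ∫ x : E n, weight q (R⁻¹ ^ 2) x with hc₁
  set c₂ : ℝ := ε ^ (-(1 / (p - 1))) * (K * R ^ (-m)) ^ (p / (p - 1))
    * ∫ x : E n, weight q (R₀⁻¹ ^ 2) x with hc₂
  set A : ℝ → ℝ := fun t => weightedPower p q R⁻¹ (ut t)
  set A₀ : ℝ → ℝ := fun t => weightedPower p q R₀⁻¹ (ut t)
  have iA : IntegrableOn A (Ioc 0 (2 * R ^ m)) :=
    h.integrableOn_weightedPower (by positivity) hq hb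
  have iA₀ : IntegrableOn A₀ (Ioc 0 (2 * R₀ ^ m)) :=
    h.integrableOn_weightedPower (by positivity) hq hb₀
  have i1 : IntegrableOn (fun t => L * A t + c₁) (Ioc 0 (2 * R ^ m)) :=
    (iA.const_mul L).add (integrableOn_const measure_Ioc_lt_top.ne)
  have i2' : IntegrableOn (fun t => (ε - L) * A₀ t + c₂) (Ioc 0 (2 * R₀ ^ m)) :=
    (iA₀.const_mul (ε - L)).add (integrableOn_const measure_Ioc_lt_top.ne)
  have i2 : IntegrableOn ((Ioc 0 (2 * R₀ ^ m)).indicator fun t => (ε - L) * A₀ t + c₂)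
      (Ioc 0 (2 * R ^ m)) := (i2'.integrable_indicator measurableSet_Ioc).integrableOn
  -- Up to time `2 R₀^m` the mass at scale `R` is split into its excess over scale `R₀`, with
  -- parameter `L`, and the mass at scale `R₀`, with parameter `ε`; together these give `L (A - A₀)
  -- + ε A₀`. At later times nothing is subtracted.
  have hle : ∫ t in Ioc (0 : ℝ) (2 * R ^ m), J t ≤ ∫ t in Ioc (0 : ℝ) (2 * R ^ m),
      ((L * A t + c₁) + (Ioc 0 (2 * R₀ ^ m)).indicator (fun t => (ε - L) * A₀ t + c₂) t) := by
    refine integral_mono_ae hJi (i1.add i2) ?_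
    filter_upwards [ae_restrict_of_ae_restrict_of_subset Ioc_subset_Ioi_self (h.ae_memLp hp),
      ae_restrict_mem measurableSet_Ioc] with t ht ht0
    refine (hJ t ht0.1).trans ?_
    by_cases hmem : t ∈ Ioc 0 (2 * R₀ ^ m)
    · rw [indicator_of_mem hmem]
      have h1 := mul_weightedMass_le hp hq hb₀ ht hε hc0
      have h2 := mul_weightedMass_sub_le hp hq hb (show R⁻¹ ≤ R₀⁻¹ by gcongr) ht hL0 hc0
      simp only [A, A₀]
      linarith
    · rw [indicator_of_notMem hmem, add_zero]
      exact mul_weightedMass_le hp hq hb ht hL0 hc0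
  have e1 : ∫ t in Ioc (0 : ℝ) (2 * R ^ m), (L * A t + c₁) = L * Y R + 2 * R ^ m * c₁ := by
    rw [integral_add (iA.const_mul L) (integrableOn_const measure_Ioc_lt_top.ne), integral_const_mul,
      setIntegral_const, smul_eq_mul, measureReal_def, Real.volume_Ioc, sub_zero,
      ENNReal.toReal_ofReal (by positivity)]
  have e2 : ∫ t in Ioc (0 : ℝ) (2 * R ^ m),
      (Ioc 0 (2 * R₀ ^ m)).indicator (fun t => (ε - L) * A₀ t + c₂) t
      = (ε - L) * Y R₀ + 2 * R₀ ^ m * c₂ := by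
    rw [setIntegral_indicator measurableSet_Ioc, inter_eq_self_of_subset_right hsub,
      integral_add (iA₀.const_mul _) (integrableOn_const measure_Ioc_lt_top.ne), integral_const_mul,
      setIntegral_const, smul_eq_mul, measureReal_def, Real.volume_Ioc, sub_zero,
      ENNReal.toReal_ofReal (by positivity)]
  rw [integral_add i1 i2, e1, e2] at hle
  have h3 : 2 * R ^ m * c₁ ≤ δ / 4 := by
    have := rpow_mul_integral_weight_le (q := q) hp hcrit hK hR
    calc _ = L ^ (-(1 / (p - 1))) * ((K * R ^ (-m)) ^ (p / (p - 1))
          * (∫ x : E n, weight q (R⁻¹ ^ 2) x) * (2 * R ^ m)) := by rw [hc₁]; ring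
      _ ≤ L ^ (-(1 / (p - 1))) * D := by gcongr
      _ ≤ δ / 4 := hL
  have h4 : L * (Y R - Y R₀) ≤ δ / 4 := by
    calc _ ≤ L * (δ / (4 * L)) := by gcongr; exact hYR₀ R hRR
      _ = δ / 4 := by field_simp
  have h5 : 2 * R₀ ^ m * c₂ ≤ δ / 4 := by linarith
  linarith

theorem not_isGlobalWeakSolutionWith (hn : 1 ≤ n) (hσ : 0 < σ) (hσ2 : σ ≤ 2) (hμ : 0 < μ)
    (hu₀ : Integrable u₀) (hu₁ : Integrable u₁) (hpos : 0 < ∫ x, u₁ x) (hp : 1 < p)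
    (hp' : p ≤ 1 + min σ 1 / n) : ¬ IsGlobalWeakSolutionWith σ μ p u₀ u₁ u ut := by
  intro h
  have hn0 : (0 : ℝ) < n := by exact_mod_cast hn
  have hp1 : 0 < p - 1 := by linarith
  have hm : 0 < min σ 1 := lt_min hσ one_pos
  have hcrit : n * (p - 1) ≤ min σ 1 := by
    have : p - 1 ≤ min σ 1 / n := by linarith
    rw [le_div_iff₀ hn0] at this
    linarith
  have hq : (n : ℝ) < 2 * ((n : ℝ) / 2 + σ / 2) := by linarith
  obtain ⟨k, hk⟩ := exists_nat_ge (p / (p - 1))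
  have hk0 : k ≠ 0 := by
    have : (0 : ℝ) < k := lt_of_lt_of_le (by positivity) hk
    exact_mod_cast this.ne'
  obtain ⟨K, hK, hW⟩ := h.exists_weakInequality hn hσ hσ2 hμ hp hk hu₀
  obtain ⟨M, hM⟩ := h.exists_bound_integral_weightedPower hW hk0 hp hq hm hK hcrit hu₁
  have hlim := tendsto_integral_mul_weight (nonneg_of_natCast_lt hq) hu₁
  have hKlim : Tendsto (fun R : ℝ => K * R ^ (-min σ 1)) atTop (𝓝 0) := by
    simpa using (tendsto_rpow_neg_atTop hm).const_mul K
  -- At this `R` the datum contributes more than half of `∫ u₁`, while `J` and the error contribute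
  -- at most a quarter each, the latter strictly less. Since the nonlinear term is nonnegative, this
  -- contradicts the weak inequality.
  obtain ⟨R, hR, h1, h2, h3⟩ := ((eventually_ge_atTop (1 : ℝ)).and
    ((h.eventually_integral_le hp hq hm hK hcrit hM
      (show 0 < (∫ x, u₁ x) / 4 by positivity)).and
    ((hlim.eventually_const_lt (show (∫ x, u₁ x) / 2 < ∫ x, u₁ x by linarith)).and
    (hKlim.eventually_lt_const (show 0 < (∫ x, u₁ x) / 4 by positivity))))).exists
  have hR0 : 0 < R := by linarith
  obtain ⟨J, hJi, hJ, hle⟩ := hW R hR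
  have h4 := h1 J hJi fun t ht => (le_abs_self _).trans ((hJ t ht).trans (by
    have hc := cutoff_nonneg (k := k) (T := R ^ min σ 1) t
    have : cutoff k (R ^ min σ 1) t ^ (1 / p) ≤ 1 :=
      Real.rpow_le_one hc (cutoff_le_one t) (by positivity)
    have hB := weightedMass_nonneg (q := (n : ℝ) / 2 + σ / 2) (b := R⁻¹) (v := ut t)
    refine mul_le_mul_of_nonneg_right (mul_le_of_le_one_right ?_ this) hB
    exact mul_nonneg hK (Real.rpow_pos_of_pos hR0 _).le))
  have h5 : 0 ≤ ∫ t in Ioi (0 : ℝ), cutoff k (R ^ min σ 1) t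
      * weightedPower p ((n : ℝ) / 2 + σ / 2) R⁻¹ (ut t) :=
    integral_nonneg fun t => mul_nonneg (cutoff_nonneg t) weightedPower_nonneg
  linarith

end nonexistence

end DampedWave

theorem theorem1p1 (n : ℕ) (hn : 1 ≤ n) (σ μ p : ℝ) (hσ : 0 < σ) (hσ2 : σ ≤ 2) (hμ : 0 < μ)
    (u₀ u₁ : DampedWave.E n → ℝ)
    (hu₀ : Integrable u₀) (hu₀' : MemLp u₀ 2)
    (hu₁ : Integrable u₁) (hu₁' : MemLp u₁ 2)
    (hpos : 0 < ∫ x, u₁ x)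
    (hp : 1 < p) (hp' : p ≤ 1 + min σ 1 / n) :
    ¬ ∃ u : ℝ → DampedWave.L2 n, DampedWave.IsGlobalWeakSolution σ μ p u₀ u₁ u := by
  rintro ⟨u, ut, h⟩
  exact DampedWave.not_isGlobalWeakSolutionWith hn hσ hσ2 hμ hu₀ hu₁ hpos hp hp' h
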